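/- Let $p$ be a prime, let $K/\mathbb{Q}_p$ be a totally ramified finite extension with ring of integers $A$, and let $q$ be the cardinality of the residue field of $A$. A formal $A$-module over a commutative $A$-algebra $R$ is a one-dimensional commutative formal group law $F$ over $R$ together with a ring homomorphism $\rho\colon A\to \mathrm{End}(F)$ with $\rho(a)(X)\equiv aX \bmod X^2$. If $R$ is torsion-free, it is called $A$-typical if its logarithm, a power series over $\mathbb{Q}\otimes_{\mathbb{Z}} R$, has the form $\sum_{n\ge 0}\ell_n X^{q^n}$ with $\ell_0=1$; over a general $R$ it is called $A$-typical if it is the image of an $A$-typical formal $A$-module under an $A$-algebra homomorphism $S\to R$ with $S$ torsion-free. Likewise, $p$-typical formal group laws over $\mathbb{Z}_{(p)}$-algebras are defined by logarithms of the form $\sum_{n\ge 0}\ell_n X^{p^n}$, $\ell_0=1$. Then there are a $\mathbb{Z}_{(p)}$-algebra $BP_*$ which carries a universal $p$-typical formal group law $G$, and an $A$-algebra $V^A$ which carries a universal $A$-typical formal $A$-module $F$. They are graded rings: the coefficients of $X^iY^j$ in $G(X,Y)$ and in $F(X,Y)$ have degree $2(i+j-1)$, and the coefficient of $X^i$ in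 $\rho(a)(X)$ has degree $2(i-1)$. There is exactly one $\mathbb{Z}_{(p)}$-algebra homomorphism $\gamma\colon BP_*\to V^A$ that sends $G$ to the formal group law underlying $F$, and $\gamma$ preserves degrees. The induced ring homomorphism \[ BP_*\otimes_{\mathbb{Z}_{(p)}} A\longrightarrow V^A,\qquad b\otimes a\mapsto \gamma(b)\,a, \] is injective, and the homomorphism \[ p^{-1}\bigl(BP_*\otimes_{\mathbb{Z}_{(p)}} A\bigr)\longrightarrow p^{-1}V^A \] that it induces is an isomorphism. -/

import Mathlib

universe u

open scoped TensorProduct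

noncomputable section

/-! ### Formal modules -/

/-- A (one-dimensional) formal `A`-module over a commutative `A`-algebra `R`: a commutative formal
group law `F` over `R` together with a ring homomorphism `ρ : A → End(F)` such that
`ρ(a)(X) ≡ a X mod X²`. Here `act a` is the power series `ρ(a)(X)`; addition in `End(F)` is
`(g, h) ↦ F(g(X), h(X))`, and multiplication is composition. -/
structure FormalModule (A : Type*) [CommRing A] (R : Type*) [CommRing R] [Algebra A R]
    extends FormalGroup R where
  isComm : toFormalGroup.IsComm
  /-- the power series `ρ(a)(X)` -/
  act : A → PowerSeries R
  act_coeff_zero : ∀ a, (act a).coeff 0 = 0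
  act_coeff_one : ∀ a, (act a).coeff 1 = algebraMap A R a
  /-- `ρ(a)` is an endomorphism of `F`: `ρ(a)(F(X, Y)) = F(ρ(a)(X), ρ(a)(Y))` -/
  act_endo : ∀ a, PowerSeries.subst toPowerSeries (act a) =
    MvPowerSeries.subst
      ![PowerSeries.subst (MvPowerSeries.X 0 : MvPowerSeries (Fin 2) R) (act a),
        PowerSeries.subst (MvPowerSeries.X 1 : MvPowerSeries (Fin 2) R) (act a)] toPowerSeries
  act_one : act 1 = PowerSeries.X
  act_add : ∀ a b, act (a + b) = MvPowerSeries.subst ![act a, act b] toPowerSeries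
  act_mul : ∀ a b, act (a * b) = PowerSeries.subst (act b) (act a)

/-- `F'` is the formal `A`-module obtained from `F` by applying `φ` to all coefficients. -/
def FormalModule.IsPushforward {A : Type*} [CommRing A] {R R' : Type*} [CommRing R] [CommRing R']
    [Algebra A R] [Algebra A R'] (φ : R →ₐ[A] R') (F : FormalModule A R)
    (F' : FormalModule A R') : Prop :=
  F.toFormalGroup.map (φ : R →+* R') = F'.toFormalGroup ∧
    ∀ a, (F.act a).map (φ : R →+* R') = F'.act a

/-! ### Typicality -/

/-- The logarithm of `F` has the form `∑ ℓₙ X^(q^n)` with `ℓ₀ = 1`. It is a power series over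
`ℚ ⊗ R`, and is the only one that starts with `X` and satisfies
`log (F(X, Y)) = log X + log Y`. (Used for `R` torsion-free as an abelian group, so that
`R ⊆ ℚ ⊗ R`.) -/
def FormalGroup.HasTypicalLog {R : Type*} [CommRing R] (q : ℕ) (F : FormalGroup R) : Prop :=
  ∃ log : PowerSeries (ℚ ⊗[ℤ] R),
    log.coeff 1 = 1 ∧ (∀ k : ℕ, (∀ n : ℕ, k ≠ q ^ n) → log.coeff k = 0) ∧
    PowerSeries.subst
        (F.map (Algebra.TensorProduct.includeRight : R →ₐ[ℤ] ℚ ⊗[ℤ] R).toRingHom).toPowerSeries log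
      = PowerSeries.subst (MvPowerSeries.X 0 : MvPowerSeries (Fin 2) (ℚ ⊗[ℤ] R)) log
        + PowerSeries.subst (MvPowerSeries.X 1 : MvPowerSeries (Fin 2) (ℚ ⊗[ℤ] R)) log

/-- `p`-typical formal group laws over a `k`-algebra `R` (to be used with `k = ℤ_(p)`): over a
torsion-free algebra this means that the logarithm is `∑ ℓₙ X^(p^n)`; over a general algebra,
where there need not be a logarithm, it means that the formal group law is the image of such a one
under a homomorphism from a torsion-free algebra. -/
def FormalGroup.IsTypical (k : Type*) [CommRing k] (p : ℕ) {R : Type u} [CommRing R] [Algebra k R]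
    (F : FormalGroup R) : Prop :=
  ∃ (S : Type u) (_ : CommRing S) (_ : Algebra k S) (G : FormalGroup S) (φ : S →ₐ[k] R),
    IsAddTorsionFree S ∧ G.HasTypicalLog p ∧ G.map (φ : S →+* R) = F

/-- `A`-typical formal `A`-modules over an `A`-algebra `R`, for `A` a discrete valuation ring of
characteristic zero with residue field of cardinality `q`: over a torsion-free algebra this means
that the logarithm is `∑ ℓₙ X^(q^n)`; over a general algebra it means that the formal module is
the image of such a one under a homomorphism from a torsion-free `A`-algebra. -/
def FormalModule.IsTypical {A : Type*} [CommRing A] (q : ℕ) {R : Type u} [CommRing R] [Algebra A R]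
    (F : FormalModule A R) : Prop :=
  ∃ (S : Type u) (_ : CommRing S) (_ : Algebra A S) (G : FormalModule A S) (φ : S →ₐ[A] R),
    IsAddTorsionFree S ∧ G.toFormalGroup.HasTypicalLog q ∧ G.IsPushforward φ F

/-! ### Classifying rings -/

/-- `G` is a universal `p`-typical formal group law over a `k`-algebra, i.e. the `k`-algebra `V`
that carries it is the classifying ring of `p`-typical formal group laws over `k`-algebras. -/
def FormalGroup.IsUniversalTypical (k : Type*) [CommRing k] (p : ℕ) {V : Type u} [CommRing V]
    [Algebra k V] (G : FormalGroup V) : Prop :=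
  G.IsTypical k p ∧
    ∀ (R : Type u) [CommRing R] [Algebra k R] (H : FormalGroup R), H.IsTypical k p →
      ∃! φ : V →ₐ[k] R, G.map (φ : V →+* R) = H

/-- `F` is a universal `A`-typical formal `A`-module, i.e. the `A`-algebra `V` that carries it is
the classifying ring `V^A` of `A`-typical formal `A`-modules. -/
def FormalModule.IsUniversalTypical {A : Type*} [CommRing A] (q : ℕ) {V : Type u} [CommRing V]
    [Algebra A V] (F : FormalModule A V) : Prop :=
  F.IsTypical q ∧
    ∀ (R : Type u) [CommRing R] [Algebra A R] (H : FormalModule A R), H.IsTypical q →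
      ∃! φ : V →ₐ[A] R, F.IsPushforward φ H

/-! ### Gradings -/

/-- The coefficients of `F(X, Y)` of degree `d`: the coefficient of `X^i Y^j` has degree
`2 (i + j - 1)`. -/
def FormalGroup.coeffsOfDegree {R : Type*} [CommRing R] (F : FormalGroup R) (d : ℕ) : Set R :=
  {x | ∃ i j : ℕ, 2 * (i + j) = d + 2 ∧
    F.toPowerSeries.coeff (Finsupp.single 0 i + Finsupp.single 1 j) = x}

/-- The coefficients of degree `d` of a formal module: those of `F(X, Y)`, and the coefficients of
`X^i` in the `ρ(a)(X)`, which have degree `2 (i - 1)`. -/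
def FormalModule.coeffsOfDegree {A : Type*} [CommRing A] {R : Type*} [CommRing R] [Algebra A R]
    (F : FormalModule A R) (d : ℕ) : Set R :=
  F.toFormalGroup.coeffsOfDegree d ∪
    {x | ∃ (a : A) (i : ℕ), 2 * i = d + 2 ∧ (F.act a).coeff i = x}

/-- The `k`-linear span of the products `c₁ ⋯ cᵣ` with `cᵢ ∈ C dᵢ` and `d₁ + ⋯ + dᵣ = d`. -/
def weightPiece (k : Type*) [CommRing k] {R : Type*} [CommRing R] [Algebra k R] (C : ℕ → Set R)
    (d : ℕ) : Submodule k R :=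
  Submodule.span k {x | ∃ l : List (ℕ × R), (∀ c ∈ l, c.2 ∈ C c.1) ∧
    (l.map Prod.fst).sum = d ∧ (l.map Prod.snd).prod = x}

/-- The degree `d` part of the ring that carries a universal formal group law. -/
def FormalGroup.grading (k : Type*) [CommRing k] {R : Type*} [CommRing R] [Algebra k R]
    (F : FormalGroup R) : ℕ → Submodule k R :=
  weightPiece k F.coeffsOfDegree

/-- The degree `d` part of the ring that carries a universal formal `A`-module. -/
def FormalModule.grading {A : Type*} [CommRing A] {R : Type*} [CommRing R] [Algebra A R]
    (F : FormalModule A R) : ℕ → Submodule A R :=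
  weightPiece A F.coeffsOfDegree

/-! ### The comparison map -/

instance isPrime_span_natCast_int (p : ℕ) [hp : Fact p.Prime] :
    (Ideal.span {(p : ℤ)}).IsPrime :=
  (Ideal.span_singleton_prime (by exact_mod_cast hp.out.ne_zero)).2
    (Nat.prime_iff_prime_int.1 hp.out)

/-- The ring `ℤ_(p)`: the integers localized at the prime ideal `(p)`. -/
abbrev LocalInt (p : ℕ) [Fact p.Prime] : Type :=
  Localization.AtPrime (Ideal.span {(p : ℤ)})

/-- The ring map `B ⊗_k A → V`, `b ⊗ a ↦ γ(b) a`, induced by a `k`-algebra map `γ : B → V` to an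
`A`-algebra `V`. -/
def comparisonMap {k : Type*} [CommRing k] (A : Type*) [CommRing A] [Algebra k A]
    {B V : Type*} [CommRing B] [Algebra k B] [CommRing V] [Algebra k V] [Algebra A V]
    [IsScalarTower k A V] (γ : B →ₐ[k] V) : B ⊗[k] A →ₐ[k] V :=
  Algebra.TensorProduct.lift γ (IsScalarTower.toAlgHom k A V) (fun _ _ => Commute.all _ _)

end

universe v w

noncomputable section

/-! ### Power series `X + ⋯` and their compositional inverses -/

namespace PowerSeries

variable {R : Type*} [CommRing R] {τ υ : Type*}

/-! Total ramification forces residue degree `1`, so `q = p` and both kinds of typicality refer to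
the same shape of logarithm `f = X + ∑ ℓₙ X^(p^n)`. For a ring of constants `k`, this `f` has a
universal version over `LogRing p k`, which is `k ⊗ ℚ[ℓ₁, ℓ₂, …]`. It determines the law `f⁻¹(f(X) +
f(Y))` and the action `f⁻¹(a f(X))`. Conversely, over a `ℚ`-algebra the logarithm forces the action
(`subst_endomorphism`).

The classifying rings are the subalgebras generated by these coefficients: with `k = ℤ_(p)` and the
law alone for `BP_*`, with `k = A` and the action as well for `V^A`. A typical law over a
torsion-free `S` has its logarithm over `ℚ ⊗ S`, hence is the image of the universal law under a
homomorphism from `LogRing p k`. This homomorphism sends the generators into `S`, and uniqueness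
holds because the coefficients generate. Scaling the variable in `f` multiplies each coefficient by
a power of a parameter, which separates the degrees.

Injectivity: `A` is a torsion-free module over the Dedekind domain `ℤ_(p)`, hence flat. So `BP_* ⊗
A` embeds into `LogRing p ℤ_(p) ⊗ A`, which is `LogRing p A`, and this embedding factors through
`V^A`.

Surjectivity after inverting `p` rests on `exists_pow_mul_mem`. If a subalgebra `W` contains the
coefficients of the law, it contains those of `[p](X)`. Comparing coefficients in `f([p](X)) = p
f(X)` expresses `(p - p^n)` times the `n`-th coefficient of `f` through earlier ones. As `p - p^n`
is `p` times a unit of `ℤ_(p)` for `n ≥ 2`, all of `LogRing p A` lies in `W[1/p]`. The image of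
`BP_* ⊗ A` is such a `W`. The same fact identifies `ℚ ⊗ W` with `LogRing p k`, so that the universal
law is typical over its own ring of definition. -/

theorem mvSubst_subst {a : MvPowerSeries τ R} (ha : MvPowerSeries.constantCoeff a = 0)
    {b : τ → MvPowerSeries υ R} (hb : MvPowerSeries.HasSubst b) (f : PowerSeries R) :
    MvPowerSeries.subst b (subst a f) = subst (MvPowerSeries.subst b a) f :=
  MvPowerSeries.subst_comp_subst_apply (HasSubst.of_constantCoeff_zero ha).const hb f

theorem subst_subst {a : PowerSeries R} (ha : constantCoeff a = 0)
    {b : MvPowerSeries υ R} (hb : MvPowerSeries.constantCoeff b = 0) (f : PowerSeries R) :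
    subst b (subst a f) = subst (subst b a) f :=
  subst_comp_subst_apply (HasSubst.of_constantCoeff_zero' ha) (HasSubst.of_constantCoeff_zero hb) f

/-- The power series `f` is of the form `X + ⋯`. -/
structure IsNormalized (f : PowerSeries R) : Prop where
  constantCoeff_eq : constantCoeff f = 0
  coeff_one_eq : coeff 1 f = 1

namespace IsNormalized

theorem map {S : Type*} [CommRing S] {f : PowerSeries R} (hf : f.IsNormalized) (φ : R →+* S) :
    (f.map φ).IsNormalized :=
  ⟨by rw [← coeff_zero_eq_constantCoeff_apply, coeff_map, coeff_zero_eq_constantCoeff_apply,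
    hf.constantCoeff_eq, map_zero], by rw [coeff_map, hf.coeff_one_eq, map_one]⟩

theorem exists_inverse {f : PowerSeries R} (hf : f.IsNormalized) :
    ∃ g : PowerSeries R, constantCoeff g = 0 ∧ subst g f = X ∧ subst f g = X := by
  let : Invertible (coeff 1 f) := hf.coeff_one_eq ▸ invertibleOne
  exact ⟨f.substInv, constantCoeff_substInv f, subst_substInv_right f hf.constantCoeff_eq,
    subst_substInv_left f hf.constantCoeff_eq⟩

variable {f : PowerSeries R} (hf : f.IsNormalized) {a b : MvPowerSeries τ R}

/-- The compositional inverse of a normalized power series. -/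
def inverse : PowerSeries R := hf.exists_inverse.choose

theorem constantCoeff_inverse : constantCoeff hf.inverse = 0 := hf.exists_inverse.choose_spec.1

theorem subst_inverse : subst hf.inverse f = X := hf.exists_inverse.choose_spec.2.1

theorem inverse_subst : subst f hf.inverse = X := hf.exists_inverse.choose_spec.2.2

theorem constantCoeff_subst_eq {f : PowerSeries R} (hf : f.IsNormalized)
    (ha : MvPowerSeries.constantCoeff a = 0) : MvPowerSeries.constantCoeff (subst a f) = 0 :=
  PowerSeries.constantCoeff_subst_eq_zero ha f hf.constantCoeff_eq

theorem constantCoeff_inverse_subst (ha : MvPowerSeries.constantCoeff a = 0) :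
    MvPowerSeries.constantCoeff (subst a hf.inverse) = 0 :=
  PowerSeries.constantCoeff_subst_eq_zero ha _ hf.constantCoeff_inverse

theorem subst_inverse_subst (ha : MvPowerSeries.constantCoeff a = 0) :
    subst (subst a hf.inverse) f = a := by
  rw [← subst_subst hf.constantCoeff_inverse ha, hf.subst_inverse,
    subst_X (HasSubst.of_constantCoeff_zero ha)]

theorem inverse_subst_subst (ha : MvPowerSeries.constantCoeff a = 0) :
    subst (subst a f) hf.inverse = a := by
  rw [← subst_subst hf.constantCoeff_eq ha, hf.inverse_subst,
    subst_X (HasSubst.of_constantCoeff_zero ha)]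

/-- A normalized series can be cancelled on the left, because it has a compositional inverse. This
reduces identities between formal group laws or actions to additive identities between logarithms.
-/
theorem subst_injective {f : PowerSeries R} (hf : f.IsNormalized)
    (ha : MvPowerSeries.constantCoeff a = 0) (hb : MvPowerSeries.constantCoeff b = 0)
    (h : subst a f = subst b f) : a = b := by
  rw [← hf.inverse_subst_subst ha, h, hf.inverse_subst_subst hb]

end IsNormalized

end PowerSeries

/-! ### Formal group laws with a given logarithm -/

namespace MvPowerSeries

variable {R : Type*} [CommRing R] {τ υ : Type*}

theorem hasSubst_pair {a b : MvPowerSeries τ R} (ha : constantCoeff a = 0)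
    (hb : constantCoeff b = 0) : HasSubst ![a, b] :=
  hasSubst_of_constantCoeff_zero fun i => by fin_cases i <;> simpa

theorem constantCoeff_subst_pair {a b : MvPowerSeries τ R} (ha : constantCoeff a = 0)
    (hb : constantCoeff b = 0) {F : MvPowerSeries (Fin 2) R} (hF : constantCoeff F = 0) :
    constantCoeff (subst ![a, b] F) = 0 :=
  constantCoeff_subst_eq_zero (hasSubst_pair ha hb) (fun i => by fin_cases i <;> simpa) hF

theorem map_subst_pair {S : Type*} [CommRing S] (φ : R →+* S) {a b : MvPowerSeries τ R}
    (ha : constantCoeff a = 0) (hb : constantCoeff b = 0) (F : MvPowerSeries (Fin 2) R) :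
    (subst ![a, b] F).map φ = subst ![a.map φ, b.map φ] (F.map φ) := by
  rw [map_subst (hasSubst_pair ha hb)]
  congr 1
  ext1 i
  fin_cases i <;> rfl

theorem subst_subst_pair {a b : MvPowerSeries τ R} (ha : constantCoeff a = 0)
    (hb : constantCoeff b = 0) {c : τ → MvPowerSeries υ R} (hc : HasSubst c)
    (F : MvPowerSeries (Fin 2) R) :
    subst c (subst ![a, b] F) = subst ![subst c a, subst c b] F := by
  rw [subst_comp_subst_apply (hasSubst_pair ha hb) hc]
  congr 1
  ext1 i
  fin_cases i <;> rfl

theorem map_injective {S : Type*} [CommRing S] {φ : R →+* S} (hφ : Function.Injective φ) :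
    Function.Injective (map (σ := τ) φ) := fun f g h => by
  ext n
  apply hφ
  rw [← coeff_map, h, coeff_map]

theorem exists_map_eq {S : Type*} [CommRing S] {φ : R →+* S} {f : MvPowerSeries τ S}
    (h : ∀ n, coeff n f ∈ φ.range) : ∃ g : MvPowerSeries τ R, g.map φ = f := by
  choose c hc using h
  exact ⟨c, by ext n; exact hc n⟩

theorem constantCoeff_eq_zero_of_map {S : Type*} [CommRing S] {φ : R →+* S}
    (hφ : Function.Injective φ) {f : MvPowerSeries τ R} (h : constantCoeff (f.map φ) = 0) :
    constantCoeff f = 0 :=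
  hφ (by rw [← constantCoeff_map, h, map_zero])

end MvPowerSeries

/-- The power series `f` is a logarithm of `F`: `f(F(X, Y)) = f(X) + f(Y)`. -/
def MvPowerSeries.HasLog {R : Type*} [CommRing R] (F : MvPowerSeries (Fin 2) R)
    (f : PowerSeries R) : Prop :=
  PowerSeries.subst F f =
    PowerSeries.subst (MvPowerSeries.X 0 : MvPowerSeries (Fin 2) R) f +
      PowerSeries.subst (MvPowerSeries.X 1 : MvPowerSeries (Fin 2) R) f

namespace MvPowerSeries.HasLog

open PowerSeries (IsNormalized)

variable {R : Type*} [CommRing R] {τ : Type*} {F : MvPowerSeries (Fin 2) R} {f : PowerSeries R}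

theorem subst_pair (h : HasLog F f) (hF : constantCoeff F = 0) {a b : MvPowerSeries τ R}
    (ha : constantCoeff a = 0) (hb : constantCoeff b = 0) :
    PowerSeries.subst (subst ![a, b] F) f = PowerSeries.subst a f + PowerSeries.subst b f := by
  have hs := hasSubst_pair ha hb
  rw [← PowerSeries.mvSubst_subst hF hs, h, subst_add hs,
    PowerSeries.mvSubst_subst (MvPowerSeries.constantCoeff_X _) hs,
    PowerSeries.mvSubst_subst (MvPowerSeries.constantCoeff_X _) hs, subst_X hs, subst_X hs]
  rfl

theorem map {S : Type*} [CommRing S] (φ : R →+* S) (h : HasLog F f) (hF : constantCoeff F = 0) :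
    HasLog (F.map φ) (f.map φ) := by
  have := congrArg (MvPowerSeries.map φ) h
  rwa [PowerSeries.map_subst (.of_constantCoeff_zero hF), map_add,
    PowerSeries.map_subst (.X _), PowerSeries.map_subst (.X _), map_X, map_X] at this

theorem eq {G : MvPowerSeries (Fin 2) R} (hf : f.IsNormalized) (hF : constantCoeff F = 0)
    (hG : constantCoeff G = 0) (h : HasLog F f) (h' : HasLog G f) : F = G :=
  hf.subst_injective hF hG (h.trans h'.symm)

end MvPowerSeries.HasLog

namespace PowerSeries.IsNormalized

open MvPowerSeries (HasLog hasSubst_pair constantCoeff_subst_pair)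

variable {R : Type*} [CommRing R] {f : PowerSeries R} (hf : f.IsNormalized)

/-- The power series `f⁻¹(f(X) + f(Y))`. -/
def lawSeries : MvPowerSeries (Fin 2) R :=
  subst (subst (MvPowerSeries.X 0 : MvPowerSeries (Fin 2) R) f +
    subst (MvPowerSeries.X 1 : MvPowerSeries (Fin 2) R) f) hf.inverse

theorem constantCoeff_add_subst_X {f : PowerSeries R} (hf : f.IsNormalized) :
    MvPowerSeries.constantCoeff (subst (MvPowerSeries.X 0 : MvPowerSeries (Fin 2) R) f +
      subst (MvPowerSeries.X 1 : MvPowerSeries (Fin 2) R) f) = 0 := by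
  rw [map_add, hf.constantCoeff_subst_eq (MvPowerSeries.constantCoeff_X _),
    hf.constantCoeff_subst_eq (MvPowerSeries.constantCoeff_X _), add_zero]

theorem constantCoeff_lawSeries : MvPowerSeries.constantCoeff hf.lawSeries = 0 :=
  hf.constantCoeff_inverse_subst hf.constantCoeff_add_subst_X

theorem hasLog_lawSeries : HasLog hf.lawSeries f :=
  hf.subst_inverse_subst hf.constantCoeff_add_subst_X

end PowerSeries.IsNormalized

/-! ### Linear coefficients of a composite series. -/

namespace MvPowerSeries

variable {R : Type*} [CommRing R] {τ : Type*}

theorem coeff_pow_eq_zero_of_degree_lt {a : MvPowerSeries τ R} (ha : constantCoeff a = 0)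
    {e : τ →₀ ℕ} {d : ℕ} (h : e.degree < d) : coeff e (a ^ d) = 0 := by
  apply coeff_of_lt_order
  have h1 : (1 : ℕ∞) ≤ a.order := by
    rw [one_le_order_iff_constCoeff_eq_zero]; exact ha
  calc ((e.degree : ℕ) : ℕ∞) < d := by exact_mod_cast h
    _ = d • (1 : ℕ∞) := by simp
    _ ≤ d • a.order := by gcongr
    _ ≤ _ := le_order_pow d

/-- Only the first power of `a` contributes: `a ^ d` has order at least `d`, and `a ^ 0 = 1` has
nothing in degree `1`. -/
theorem coeff_subst_of_degree_eq_one {a : MvPowerSeries τ R} (ha : constantCoeff a = 0)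
    (f : PowerSeries R) {e : τ →₀ ℕ} (he : e.degree = 1) :
    coeff e (PowerSeries.subst a f) = PowerSeries.coeff 1 f * coeff e a := by
  rw [PowerSeries.coeff_subst (.of_constantCoeff_zero ha), finsum_eq_single _ 1]
  · simp
  · intro d hd
    rcases Nat.lt_or_ge 1 d with h | h
    · rw [coeff_pow_eq_zero_of_degree_lt ha (he ▸ h), smul_zero]
    · obtain rfl : d = 0 := by omega
      have : coeff e (1 : MvPowerSeries τ R) = 0 := by
        classical
        rw [coeff_one, if_neg]
        rintro rfl
        simp at he
      simp [this]

end MvPowerSeries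

namespace PowerSeries.IsNormalized

open MvPowerSeries (HasLog hasSubst_pair constantCoeff_subst_pair)

variable {R : Type*} [CommRing R] {f : PowerSeries R} (hf : f.IsNormalized)

theorem coeff_lawSeries_single (i : Fin 2) :
    MvPowerSeries.coeff (Finsupp.single i 1) hf.lawSeries = 1 := by
  have h := congrArg (MvPowerSeries.coeff (Finsupp.single i 1)) hf.hasLog_lawSeries
  have hd : (Finsupp.single i 1 : Fin 2 →₀ ℕ).degree = 1 := by simp
  rw [map_add, MvPowerSeries.coeff_subst_of_degree_eq_one hf.constantCoeff_lawSeries _ hd,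
    MvPowerSeries.coeff_subst_of_degree_eq_one (MvPowerSeries.constantCoeff_X _) _ hd,
    MvPowerSeries.coeff_subst_of_degree_eq_one (MvPowerSeries.constantCoeff_X _) _ hd, hf.coeff_one_eq,
    one_mul, one_mul, one_mul] at h
  rw [h]
  fin_cases i <;> simp [MvPowerSeries.coeff_index_single_X]

/-- The formal group law with logarithm `f`. -/
@[simps toPowerSeries]
def law : FormalGroup R where
  toPowerSeries := hf.lawSeries
  zero_constantCoeff := hf.constantCoeff_lawSeries
  lin_coeff_X := hf.coeff_lawSeries_single 0
  lin_coeff_Y := hf.coeff_lawSeries_single 1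
  assoc := by
    have h0 := hf.constantCoeff_lawSeries
    have hX (i : Fin 3) := MvPowerSeries.constantCoeff_X (R := R) i
    have hXX (i j : Fin 3) := constantCoeff_subst_pair (hX i) (hX j) h0
    have hl := hf.hasLog_lawSeries
    -- After applying `f`, both bracketings become `f(X) + f(Y) + f(Z)`.
    apply hf.subst_injective (constantCoeff_subst_pair (hXX _ _) (hX _) h0)
      (constantCoeff_subst_pair (hX _) (hXX _ _) h0)
    rw [hl.subst_pair h0 (hXX _ _) (hX _), hl.subst_pair h0 (hX _) (hX _),
      hl.subst_pair h0 (hX _) (hXX _ _), hl.subst_pair h0 (hX _) (hX _), add_assoc]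

theorem hasLog_law : HasLog hf.law.toPowerSeries f := hf.hasLog_lawSeries

instance isComm_law : hf.law.IsComm where
  comm := by
    have h0 := hf.constantCoeff_lawSeries
    have hX (i : Fin 2) := MvPowerSeries.constantCoeff_X (R := R) i
    apply hf.subst_injective h0 (constantCoeff_subst_pair (hX _) (hX _) h0)
    rw [hf.hasLog_lawSeries.subst_pair h0 (hX _) (hX _), hf.hasLog_lawSeries,
      add_comm]

variable {A : Type*} [CommRing A] [Algebra A R]

/-- The power series `f⁻¹(a f(X))`. -/
def actSeries (r : R) : PowerSeries R := subst (r • f) hf.inverse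

theorem constantCoeff_smul {f : PowerSeries R} (hf : f.IsNormalized) (r : R) :
    constantCoeff (r • f) = 0 := by
  rw [smul_eq_C_mul, map_mul, hf.constantCoeff_eq, mul_zero]

theorem constantCoeff_actSeries (r : R) : constantCoeff (hf.actSeries r) = 0 :=
  hf.constantCoeff_inverse_subst (hf.constantCoeff_smul r)

theorem subst_actSeries (r : R) : subst (hf.actSeries r) f = r • f :=
  hf.subst_inverse_subst (hf.constantCoeff_smul r)

theorem subst_actSeries_subst {τ : Type*} (r : R) {b : MvPowerSeries τ R}
    (hb : MvPowerSeries.constantCoeff b = 0) :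
    subst (subst b (hf.actSeries r)) f = r • subst b f := by
  rw [← subst_subst (hf.constantCoeff_actSeries r) hb, hf.subst_actSeries,
    subst_smul (.of_constantCoeff_zero hb)]

variable (A) in
/-- The formal `A`-module with logarithm `f`. -/
def formalModule : FormalModule A R where
  toFormalGroup := hf.law
  isComm := hf.isComm_law
  act a := hf.actSeries (algebraMap A R a)
  act_coeff_zero a := by
    rw [coeff_zero_eq_constantCoeff_apply, hf.constantCoeff_actSeries]
  act_coeff_one a := by
    have h := congrArg (MvPowerSeries.coeff (Finsupp.single () 1))
      (hf.subst_actSeries (algebraMap A R a))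
    rw [MvPowerSeries.coeff_subst_of_degree_eq_one (hf.constantCoeff_actSeries _) _ (by simp),
      hf.coeff_one_eq, one_mul] at h
    refine h.trans ?_
    change coeff 1 (algebraMap A R a • f) = _
    rw [map_smul, hf.coeff_one_eq, smul_eq_mul, mul_one]
  act_endo a := by
    have h0 := hf.constantCoeff_lawSeries
    have hX (i : Fin 2) := MvPowerSeries.constantCoeff_X (R := R) i
    have hA (i : Fin 2) : MvPowerSeries.constantCoeff
        (subst (MvPowerSeries.X i : MvPowerSeries (Fin 2) R)
          (hf.actSeries (algebraMap A R a))) = 0 :=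
      PowerSeries.constantCoeff_subst_eq_zero (hX i) _ (hf.constantCoeff_actSeries _)
    apply hf.subst_injective
      (PowerSeries.constantCoeff_subst_eq_zero h0 _ (hf.constantCoeff_actSeries _))
      (constantCoeff_subst_pair (hA _) (hA _) h0)
    rw [hf.hasLog_lawSeries.subst_pair h0 (hA _) (hA _),
      hf.subst_actSeries_subst _ h0, hf.subst_actSeries_subst _ (hX _),
      hf.subst_actSeries_subst _ (hX _), hf.hasLog_lawSeries, smul_add]
  act_one := by
    apply hf.subst_injective (hf.constantCoeff_actSeries _) (MvPowerSeries.constantCoeff_X _)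
    rw [hf.subst_actSeries, map_one, one_smul]
    exact (X_subst f).symm
  act_add a b := by
    have h0 := hf.constantCoeff_lawSeries
    have hA (r : R) := hf.constantCoeff_actSeries r
    apply hf.subst_injective (hA _) (constantCoeff_subst_pair (hA _) (hA _) h0)
    rw [hf.hasLog_lawSeries.subst_pair h0 (hA _) (hA _), hf.subst_actSeries,
      hf.subst_actSeries, hf.subst_actSeries, map_add, add_smul]
  act_mul a b := by
    have hA (r : R) := hf.constantCoeff_actSeries r
    apply hf.subst_injective (hA _) (PowerSeries.constantCoeff_subst_eq_zero (hA _) _ (hA _))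
    rw [hf.subst_actSeries_subst _ (hA _), hf.subst_actSeries, hf.subst_actSeries, map_mul,
      mul_smul]

end PowerSeries.IsNormalized

/-! ### Endomorphisms in terms of the logarithm -/

namespace PowerSeries.IsNormalized

open MvPowerSeries (HasLog hasSubst_pair constantCoeff_subst_pair)

variable {R : Type*} [CommRing R] [Algebra ℚ R] {f : PowerSeries R}

/-- Over a `ℚ`-algebra, the logarithm turns an endomorphism into multiplication with its linear
coefficient. -/
theorem subst_endomorphism (hf : f.IsNormalized) {F : MvPowerSeries (Fin 2) R}
    (hF : MvPowerSeries.constantCoeff F = 0) (hl : HasLog F f) {h : PowerSeries R}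
    (h0 : constantCoeff h = 0)
    (hh : subst F h = MvPowerSeries.subst
      ![subst (MvPowerSeries.X 0 : MvPowerSeries (Fin 2) R) h,
        subst (MvPowerSeries.X 1 : MvPowerSeries (Fin 2) R) h] F) :
    subst h f = coeff 1 h • f := by
  set g := hf.inverse
  have hg : constantCoeff g = 0 := hf.constantCoeff_inverse
  set w : PowerSeries R := subst (subst g h) f with hw
  have hgh : constantCoeff (subst g h) = 0 := PowerSeries.constantCoeff_subst_eq_zero hg _ h0
  have hs := hasSubst_pair (R := R) (τ := Unit) hg hg
  have h2 : constantCoeff ((2 : R) • X : PowerSeries R) = 0 := by simp [smul_eq_C_mul]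
  -- Conjugating by the logarithm turns `F` into addition. On the diagonal this is doubling, which
  -- is enough to pin down `w = f ∘ h ∘ f⁻¹`.
  have hFg : MvPowerSeries.subst ![g, g] F = subst ((2 : R) • X : PowerSeries R) g := by
    apply hf.subst_injective (constantCoeff_subst_pair hg hg hF)
      (PowerSeries.constantCoeff_subst_eq_zero h2 _ hg)
    rw [hl.subst_pair hF hg hg, hf.subst_inverse_subst h2, hf.subst_inverse, two_smul]
  have key : subst ((2 : R) • X : PowerSeries R) w = (2 : R) • w := by
    have e1 := congrArg (MvPowerSeries.subst ![g, g]) hh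
    have hX (i : Fin 2) := MvPowerSeries.constantCoeff_X (R := R) i
    have hA (i : Fin 2) : MvPowerSeries.constantCoeff
        (subst (MvPowerSeries.X i : MvPowerSeries (Fin 2) R) h) = 0 :=
      PowerSeries.constantCoeff_subst_eq_zero (hX i) _ h0
    rw [mvSubst_subst hF hs, MvPowerSeries.subst_subst_pair (hA _) (hA _) hs,
      mvSubst_subst (hX _) hs, mvSubst_subst (hX _) hs, MvPowerSeries.subst_X hs,
      MvPowerSeries.subst_X hs, hFg] at e1
    have e2 := congrArg (fun s => subst s f) e1
    have e3 : subst (MvPowerSeries.subst ![subst g h, subst g h] F) f = (2 : R) • w := by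
      rw [hl.subst_pair hF hgh hgh, two_smul]
    refine Eq.trans ?_ (e2.trans e3)
    rw [hw, subst_subst hgh h2, subst_subst hg h2]
  -- From `w(2X) = 2 w(X)` the factor `2^n - 2` kills the `n`-th coefficient, and it is a nonzero
  -- rational for `n ≠ 1`.
  have hcoeff : ∀ n, n ≠ 1 → coeff n w = 0 := by
    intro n hn
    have e := congrArg (coeff n) key
    rw [← rescale_eq_subst, coeff_rescale, map_smul, smul_eq_mul] at e
    have hne : ((2 : ℚ) ^ n - 2) ≠ 0 := by
      rcases Nat.lt_or_ge n 1 with h | h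
      · obtain rfl : n = 0 := by omega
        norm_num
      · have : (2 : ℚ) ^ 1 < 2 ^ n := pow_lt_pow_right₀ (by norm_num) (by omega)
        intro h'
        linarith
    have hu : IsUnit (algebraMap ℚ R (2 ^ n - 2)) := (IsUnit.mk0 _ hne).map _
    refine (hu.mul_right_eq_zero).1 ?_
    rw [map_sub, map_pow, map_ofNat, sub_mul, e, sub_self]
  have hw1 : w = coeff 1 w • X := by
    ext n
    rw [map_smul, coeff_X, smul_eq_mul]
    split_ifs with hn
    · rw [hn, mul_one]
    · rw [hcoeff n hn, mul_zero]
  have hwf : subst h f = coeff 1 w • f := by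
    rw [← subst_X (R := R) (S := R) (a := f) (.of_constantCoeff_zero' hf.constantCoeff_eq),
      ← subst_smul (.of_constantCoeff_zero' hf.constantCoeff_eq), ← hw1, hw,
      subst_subst hgh hf.constantCoeff_eq, subst_subst hg hf.constantCoeff_eq, hf.inverse_subst,
      subst_X (.of_constantCoeff_zero' hf.constantCoeff_eq)]
    congr 1
    exact (X_subst h).symm
  -- So far the factor is the linear coefficient of `w`; comparing linear terms identifies it with
  -- that of `h`.
  have h1 : coeff 1 (subst h f) = coeff 1 f * coeff 1 h :=
    MvPowerSeries.coeff_subst_of_degree_eq_one h0 f (by simp)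
  rw [hwf, map_smul, hf.coeff_one_eq, smul_eq_mul, mul_one, one_mul] at h1
  rw [hwf, h1]

end PowerSeries.IsNormalized

/-! ### Change of rings -/

namespace FormalGroup

variable {R S T : Type*} [CommRing R] [CommRing S] [CommRing T]

theorem map_id (F : FormalGroup R) : F.map (RingHom.id R) = F := by
  ext n
  simp

theorem map_map (F : FormalGroup R) (φ : R →+* S) (ψ : S →+* T) :
    (F.map φ).map ψ = F.map (ψ.comp φ) := by
  ext n
  simp

theorem coeff_map (F : FormalGroup R) (φ : R →+* S) (n : Fin 2 →₀ ℕ) :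
    (F.map φ).toPowerSeries.coeff n = φ (F.toPowerSeries.coeff n) := by
  simp

/-- A formal group law descends to a subring that contains its coefficients. -/
theorem exists_map_eq {φ : R →+* S} (hφ : Function.Injective φ) (F : FormalGroup S)
    (h : ∀ n, F.toPowerSeries.coeff n ∈ φ.range) : ∃ F₀ : FormalGroup R, F₀.map φ = F := by
  obtain ⟨F₀, hF₀⟩ := MvPowerSeries.exists_map_eq h
  have h0 : MvPowerSeries.constantCoeff F₀ = 0 := by
    apply MvPowerSeries.constantCoeff_eq_zero_of_map hφ
    rw [hF₀, F.zero_constantCoeff]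
  have hX (i : Fin 3) := MvPowerSeries.constantCoeff_X (R := R) i
  have hXX (i j : Fin 3) := MvPowerSeries.constantCoeff_subst_pair (hX i) (hX j) h0
  refine ⟨⟨F₀, h0, ?_, ?_, ?_⟩, FormalGroup.ext hF₀⟩
  -- Every axiom is an identity of coefficients or of series, so it may be checked after the
  -- injective base change.
  · apply hφ
    rw [← MvPowerSeries.coeff_map, hF₀, F.lin_coeff_X, map_one]
  · apply hφ
    rw [← MvPowerSeries.coeff_map, hF₀, F.lin_coeff_Y, map_one]
  · apply MvPowerSeries.map_injective hφ
    rw [MvPowerSeries.map_subst_pair φ (hXX _ _) (hX _), MvPowerSeries.map_subst_pair φ (hX _) (hX _),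
      MvPowerSeries.map_subst_pair φ (hX _) (hXX _ _), MvPowerSeries.map_subst_pair φ (hX _) (hX _),
      hF₀, MvPowerSeries.map_X, MvPowerSeries.map_X, MvPowerSeries.map_X]
    exact F.assoc

theorem hasTypicalLog_iff {q : ℕ} {F : FormalGroup R} :
    F.HasTypicalLog q ↔ ∃ log : PowerSeries (ℚ ⊗[ℤ] R), log.coeff 1 = 1 ∧
      (∀ k : ℕ, (∀ n : ℕ, k ≠ q ^ n) → log.coeff k = 0) ∧
      (F.map (Algebra.TensorProduct.includeRight : R →ₐ[ℤ] ℚ ⊗[ℤ] R).toRingHom).toPowerSeries.HasLog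
        log :=
  Iff.rfl

end FormalGroup

namespace FormalModule

variable {A R S T : Type*} [CommRing A] [CommRing R] [CommRing S] [CommRing T] [Algebra A R]
  [Algebra A S] [Algebra A T]

theorem IsPushforward.refl (F : FormalModule A R) : F.IsPushforward (AlgHom.id A R) F :=
  ⟨F.map_id, fun a => by ext; simp⟩

theorem IsPushforward.trans {φ : R →ₐ[A] S} {ψ : S →ₐ[A] T} {F : FormalModule A R}
    {G : FormalModule A S} {H : FormalModule A T} (h : F.IsPushforward φ G)
    (h' : G.IsPushforward ψ H) : F.IsPushforward (ψ.comp φ) H := by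
  refine ⟨?_, fun a => ?_⟩
  · rw [← h'.1, ← h.1, FormalGroup.map_map]
    rfl
  · rw [← h'.2 a, ← h.2 a]
    ext
    simp

theorem constantCoeff_act (F : FormalModule A R) (a : A) :
    PowerSeries.constantCoeff (F.act a) = 0 := by
  rw [← PowerSeries.coeff_zero_eq_constantCoeff_apply, F.act_coeff_zero]

/-- A formal `A`-module descends to a subalgebra that contains its coefficients. -/
theorem exists_isPushforward {φ : R →ₐ[A] S} (hφ : Function.Injective φ) (F : FormalModule A S)
    (h : ∀ n, F.toPowerSeries.coeff n ∈ (φ : R →+* S).range)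
    (h' : ∀ a n, (F.act a).coeff n ∈ (φ : R →+* S).range) :
    ∃ F₀ : FormalModule A R, F₀.IsPushforward φ F := by
  have hφ' : Function.Injective (φ : R →+* S) := hφ
  obtain ⟨F₀, hF₀⟩ := FormalGroup.exists_map_eq hφ' F.toFormalGroup h
  have hF₀' : F₀.toPowerSeries.map (φ : R →+* S) = F.toPowerSeries :=
    congrArg FormalGroup.toPowerSeries hF₀
  have hex (a : A) : ∃ g : PowerSeries R, g.map (φ : R →+* S) = F.act a :=
    MvPowerSeries.exists_map_eq fun n => by
      have := h' a (n ())
      rwa [PowerSeries.coeff, ← Finsupp.unique_single n] at this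
  choose g hg using hex
  have hinj {τ : Type} : Function.Injective (MvPowerSeries.map (σ := τ) (φ : R →+* S)) :=
    MvPowerSeries.map_injective hφ'
  have hinj' : Function.Injective (PowerSeries.map (φ : R →+* S)) := hinj
  have h0 := F₀.zero_constantCoeff
  have hg0 (a : A) : MvPowerSeries.constantCoeff (g a) = 0 :=
    MvPowerSeries.constantCoeff_eq_zero_of_map hφ'
      ((congrArg PowerSeries.constantCoeff (hg a)).trans (F.constantCoeff_act a))
  have hX (i : Fin 2) := MvPowerSeries.constantCoeff_X (R := R) i
  have hgX (a : A) (i : Fin 2) : MvPowerSeries.constantCoeff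
      (PowerSeries.subst (MvPowerSeries.X i : MvPowerSeries (Fin 2) R) (g a)) = 0 :=
    PowerSeries.constantCoeff_subst_eq_zero (hX i) _ (hg0 a)
  refine ⟨⟨F₀, ⟨?_⟩, g, fun a => ?_, fun a => ?_, fun a => ?_, ?_, fun a b => ?_, fun a b => ?_⟩,
    hF₀, hg⟩
  · apply hinj
    rw [MvPowerSeries.map_subst_pair _ (hX _) (hX _), hF₀', MvPowerSeries.map_X,
      MvPowerSeries.map_X]
    exact F.isComm.comm
  · apply hφ'
    rw [← PowerSeries.coeff_map, hg, F.act_coeff_zero, map_zero]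
  · apply hφ'
    rw [← PowerSeries.coeff_map, hg, F.act_coeff_one]
    exact (φ.commutes a).symm
  · apply hinj
    rw [PowerSeries.map_subst (.of_constantCoeff_zero h0), hg, hF₀', F.act_endo,
      MvPowerSeries.map_subst_pair _ (hgX _ _) (hgX _ _), PowerSeries.map_subst (.X _),
      PowerSeries.map_subst (.X _), hg, hF₀', MvPowerSeries.map_X, MvPowerSeries.map_X]
  · apply hinj'
    rw [hg, F.act_one, PowerSeries.map_X]
  · apply hinj'
    rw [hg, F.act_add, ← hF₀', ← hg, ← hg]
    exact (MvPowerSeries.map_subst_pair _ (hg0 _) (hg0 _) _).symm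
  · apply hinj'
    rw [hg, F.act_mul, ← hg, ← hg]
    exact (PowerSeries.map_subst (.of_constantCoeff_zero (hg0 _)) _).symm

end FormalModule

/-! ### Coefficients and their degrees -/

namespace FormalGroup

variable {R S : Type*} [CommRing R] [CommRing S]

theorem image_coeffsOfDegree (F : FormalGroup R) (φ : R →+* S) (d : ℕ) :
    φ '' F.coeffsOfDegree d = (F.map φ).coeffsOfDegree d := by
  ext x
  constructor
  · rintro ⟨_, ⟨i, j, h, rfl⟩, rfl⟩
    exact ⟨i, j, h, F.coeff_map φ _⟩
  · rintro ⟨i, j, h, rfl⟩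
    exact ⟨_, ⟨i, j, h, rfl⟩, (F.coeff_map φ _).symm⟩

/-- A subset that contains `0` contains all coefficients as soon as it contains those that have a
degree. -/
theorem coeff_mem {F : FormalGroup R} {s : Set R} (h0 : (0 : R) ∈ s)
    (hs : ∀ d, F.coeffsOfDegree d ⊆ s) (n : Fin 2 →₀ ℕ) : F.toPowerSeries.coeff n ∈ s := by
  have hn : n = Finsupp.single 0 (n 0) + Finsupp.single 1 (n 1) := by
    ext i
    fin_cases i <;> simp
  -- The constant term would have degree `-2` and belongs to no `coeffsOfDegree d`; it vanishes,
  -- which is why `0 ∈ s` is required.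
  rcases Nat.eq_zero_or_pos (n 0 + n 1) with h | h
  · have : n = 0 := by
      rw [hn, Nat.eq_zero_of_add_eq_zero_right h, Nat.eq_zero_of_add_eq_zero_left h]
      simp
    rw [this, MvPowerSeries.coeff_zero_eq_constantCoeff_apply, F.zero_constantCoeff]
    exact h0
  · exact hs (2 * (n 0 + n 1 - 1)) ⟨n 0, n 1, by omega, by rw [← hn]⟩

end FormalGroup

namespace FormalModule

variable {A R S : Type*} [CommRing A] [CommRing R] [CommRing S] [Algebra A R] [Algebra A S]

theorem image_coeffsOfDegree {F : FormalModule A R} {G : FormalModule A S} {φ : R →ₐ[A] S}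
    (h : F.IsPushforward φ G) (d : ℕ) : φ '' F.coeffsOfDegree d = G.coeffsOfDegree d := by
  rw [coeffsOfDegree, coeffsOfDegree, Set.image_union, ← h.1,
    ← FormalGroup.image_coeffsOfDegree]
  congr 1
  ext x
  constructor
  · rintro ⟨_, ⟨a, i, hi, rfl⟩, rfl⟩
    exact ⟨a, i, hi, by rw [← h.2, PowerSeries.coeff_map]; rfl⟩
  · rintro ⟨a, i, hi, rfl⟩
    exact ⟨_, ⟨a, i, hi, rfl⟩, by rw [← h.2, PowerSeries.coeff_map]; rfl⟩

theorem act_coeff_mem {F : FormalModule A R} {s : Set R} (h0 : (0 : R) ∈ s)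
    (hs : ∀ d, F.coeffsOfDegree d ⊆ s) (a : A) (n : ℕ) : (F.act a).coeff n ∈ s := by
  rcases n with _ | n
  · rw [F.act_coeff_zero]
    exact h0
  · exact hs (2 * n) (Or.inr ⟨a, n + 1, by omega, rfl⟩)

end FormalModule

/-! ### The universal typical logarithm -/

/-- The powers of `q` other than `1`. -/
def typicalExponents (q : ℕ) : Set ℕ := {m | 1 < m ∧ ∃ n, m = q ^ n}

/-- The ring `k ⊗ ℚ[ℓ₁, ℓ₂, …]`, which carries the universal logarithm
`X + ∑ ℓₙ X^(q^n)` over `k`-algebras that contain `ℚ`. -/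
def LogRing (q : ℕ) (k : Type w) [CommRing k] : Type (max v w) :=
  k ⊗[ℤ] MvPolynomial (ULift.{v} (typicalExponents q)) ℚ

namespace LogRing

variable (q : ℕ) (k : Type w) [CommRing k]

instance : CommRing (LogRing.{v} q k) :=
  inferInstanceAs (CommRing (k ⊗[ℤ] MvPolynomial (ULift.{v} (typicalExponents q)) ℚ))

instance : Algebra k (LogRing.{v} q k) :=
  inferInstanceAs (Algebra k (k ⊗[ℤ] MvPolynomial (ULift.{v} (typicalExponents q)) ℚ))

instance : Algebra ℚ (LogRing.{v} q k) :=
  RingHom.toAlgebra (RingHom.comp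
    (Algebra.TensorProduct.includeRight :
      _ →ₐ[ℤ] k ⊗[ℤ] MvPolynomial (ULift.{v} (typicalExponents q)) ℚ).toRingHom MvPolynomial.C)

instance : IsAddTorsionFree (LogRing.{v} q k) := IsAddTorsionFree.of_module_rat _

/-- The coefficient `ℓₙ` of `X^(q^n)`. -/
def var (m : typicalExponents q) : LogRing.{v} q k :=
  (1 : k) ⊗ₜ[ℤ] (MvPolynomial.X (ULift.up m) : MvPolynomial (ULift.{v} (typicalExponents q)) ℚ)

open scoped Classical in
/-- The universal logarithm `X + ∑ ℓₙ X^(q^n)`. -/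
def log : PowerSeries (LogRing.{v} q k) :=
  PowerSeries.mk fun m =>
    if h : m ∈ typicalExponents q then var q k ⟨m, h⟩ else if m = 1 then 1 else 0

variable {q}

theorem coeff_log_of_mem (m : typicalExponents q) :
    (log.{v} q k).coeff m = var q k m := by
  rw [log, PowerSeries.coeff_mk, dif_pos m.2]

theorem coeff_log_one : (log.{v} q k).coeff 1 = 1 := by
  rw [log, PowerSeries.coeff_mk, dif_neg (fun h => lt_irrefl 1 h.1), if_pos rfl]

theorem coeff_log_of_notMem {m : ℕ} (h : m ∉ typicalExponents q) (h1 : m ≠ 1) :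
    (log.{v} q k).coeff m = 0 := by
  rw [log, PowerSeries.coeff_mk, dif_neg h, if_neg h1]

variable (q) in
theorem isNormalized_log : (log.{v} q k).IsNormalized where
  constantCoeff_eq := by
    rw [← PowerSeries.coeff_zero_eq_constantCoeff_apply]
    exact coeff_log_of_notMem k (fun h => by simpa using h.1) zero_ne_one
  coeff_one_eq := coeff_log_one k

theorem coeff_log_eq_zero {m : ℕ} (h : ∀ n, m ≠ q ^ n) : (log.{v} q k).coeff m = 0 :=
  coeff_log_of_notMem k (fun h' => h'.2.elim h) (by simpa using h 0)

variable {k} {Q : Type*} [CommRing Q] [Algebra ℚ Q]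

/-- A ring homomorphism from `LogRing q k` to a `ℚ`-algebra is given by its restriction to `k` and
by the images of the `ℓₙ`. -/
def lift (i : k →+* Q) (x : typicalExponents q → Q) : LogRing.{v} q k →+* Q :=
  (Algebra.TensorProduct.lift i.toIntAlgHom
    ((MvPolynomial.aeval fun m : ULift.{v} (typicalExponents q) => x m.down :
      _ →ₐ[ℚ] Q).restrictScalars ℤ)
    fun _ _ => Commute.all _ _).toRingHom

theorem lift_algebraMap (i : k →+* Q) (x : typicalExponents q → Q) (a : k) :
    lift.{v} i x (algebraMap k (LogRing q k) a) = i a := by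
  refine (Algebra.TensorProduct.lift_tmul _ _ _ a 1).trans ?_
  simp

theorem lift_var (i : k →+* Q) (x : typicalExponents q → Q) (m : typicalExponents q) :
    lift.{v} i x (var q k m) = x m := by
  refine (Algebra.TensorProduct.lift_tmul _ _ _ _ _).trans ?_
  simp

/-- The constants, the rationals and the `ℓₙ` generate `LogRing q k` as a ring. -/
theorem mem_of_subring (D : Subring (LogRing.{v} q k)) (hk : ∀ a, algebraMap k _ a ∈ D)
    (hQ : ∀ a : ℚ, algebraMap ℚ _ a ∈ D) (hv : ∀ m, var q k m ∈ D) (x : LogRing.{v} q k) :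
    x ∈ D := by
  refine TensorProduct.induction_on x D.zero_mem (fun a y => ?_) fun _ _ => D.add_mem
  have hy : ((1 : k) ⊗ₜ[ℤ] y : LogRing.{v} q k) ∈ D := by
    induction y using MvPolynomial.induction_on with
    | C r => exact hQ r
    | add y z hy hz =>
      rw [TensorProduct.tmul_add]
      exact D.add_mem hy hz
    | mul_X y m hy =>
      have := D.mul_mem hy (hv m.down)
      erw [var, Algebra.TensorProduct.tmul_mul_tmul, one_mul] at this
      exact this
  have := D.mul_mem (hk a) hy
  erw [Algebra.TensorProduct.algebraMap_apply, Algebra.TensorProduct.tmul_mul_tmul, one_mul] at this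
  simpa using this

theorem map_log_lift (hq : q ≠ 0) (i : k →+* Q) {f : PowerSeries Q} (h1 : f.coeff 1 = 1)
    (hf : ∀ m, (∀ n, m ≠ q ^ n) → f.coeff m = 0) :
    (log.{v} q k).map (lift i fun m => f.coeff m) = f := by
  ext m
  rw [PowerSeries.coeff_map]
  by_cases hm : m ∈ typicalExponents q
  · rw [coeff_log_of_mem k ⟨m, hm⟩, lift_var]
  · rcases eq_or_ne m 1 with rfl | hm1
    · rw [coeff_log_one, map_one, h1]
    · rw [coeff_log_of_notMem k hm hm1, map_zero]
      by_cases h : ∃ n, m = q ^ n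
      · obtain rfl : m = 0 := by
          by_contra h0
          exact hm ⟨by omega, h⟩
        obtain ⟨n, hn⟩ := h
        exact absurd hn.symm (pow_ne_zero n hq)
      · exact (hf m fun n hn => h ⟨n, hn⟩).symm

end LogRing

/-! ### Denominators of the universal logarithm -/

namespace FormalGroup

variable {R : Type*} [CommRing R]

/-- The power series `[n](X)` of a formal group law. -/
def multiplication (F : FormalGroup R) : ℕ → PowerSeries R
  | 0 => 0
  | n + 1 => MvPowerSeries.subst ![PowerSeries.X, F.multiplication n] F.toPowerSeries

theorem constantCoeff_multiplication (F : FormalGroup R) (n : ℕ) :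
    PowerSeries.constantCoeff (F.multiplication n) = 0 := by
  induction n with
  | zero => exact map_zero _
  | succ n ih =>
    exact MvPowerSeries.constantCoeff_subst_pair (MvPowerSeries.constantCoeff_X _) ih
      F.zero_constantCoeff

theorem subst_multiplication {F : FormalGroup R} {f : PowerSeries R} (hf : f.IsNormalized)
    (h : F.toPowerSeries.HasLog f) (n : ℕ) :
    PowerSeries.subst (F.multiplication n) f = (n : R) • f := by
  induction n with
  | zero =>
    rw [Nat.cast_zero, zero_smul]
    exact PowerSeries.subst_zero_of_constantCoeff_zero hf.constantCoeff_eq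
  | succ n ih =>
    refine (h.subst_pair F.zero_constantCoeff (MvPowerSeries.constantCoeff_X _)
      (F.constantCoeff_multiplication n)).trans ?_
    rw [ih, Nat.cast_succ, add_smul, one_smul, add_comm]
    congr 1
    exact PowerSeries.X_subst f

theorem map_multiplication {S : Type*} [CommRing S] (F : FormalGroup R) (φ : R →+* S) (n : ℕ) :
    (F.multiplication n).map φ = (F.map φ).multiplication n := by
  induction n with
  | zero => exact map_zero _
  | succ n ih =>
    refine (MvPowerSeries.map_subst_pair φ (MvPowerSeries.constantCoeff_X _)
      (F.constantCoeff_multiplication n) _).trans ?_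
    rw [multiplication, ← ih, ← PowerSeries.map_X φ]
    rfl

end FormalGroup

/-! ### Coefficients of a composite as a recursion. -/

namespace PowerSeries

variable {R : Type*} [CommRing R]

theorem coeff_pow_self {h : PowerSeries R} (h0 : constantCoeff h = 0) (n : ℕ) :
    coeff n (h ^ n) = coeff 1 h ^ n := by
  obtain ⟨g, rfl⟩ := X_dvd_iff.2 h0
  rw [mul_pow, coeff_X_pow_mul', if_pos le_rfl, Nat.sub_self, coeff_zero_eq_constantCoeff_apply,
    map_pow]
  congr 1
  rw [← zero_add 1, coeff_succ_X_mul, coeff_zero_eq_constantCoeff_apply]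

/-- Powers `h ^ m` with `m > n` start too late to contribute, and the term `m = n` sees only the
linear coefficient of `h`. Isolating that term makes the functional equation of a logarithm
recursive. -/
theorem coeff_subst_eq_sum {h : PowerSeries R} (h0 : constantCoeff h = 0) (f : PowerSeries R)
    (n : ℕ) : coeff n (subst h f) =
      ∑ m ∈ Finset.range n, coeff m f * coeff n (h ^ m) + coeff n f * coeff 1 h ^ n := by
  rw [← coeff_pow_self h0, ← Finset.sum_range_succ (fun m => coeff m f * coeff n (h ^ m)),
    coeff_subst' (.of_constantCoeff_zero' h0)]
  refine finsum_eq_finsetSum_of_support_subset _ fun m hm => ?_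
  by_contra hmn
  refine hm ?_
  have : coeff n (h ^ m) = 0 := MvPowerSeries.coeff_pow_eq_zero_of_degree_lt h0
    (by simpa using hmn)
  simp [this]

end PowerSeries

section LocalInt

variable {p : ℕ} [Fact p.Prime]

theorem isUnit_natCast_of_not_dvd {k : Type*} [CommRing k] [Algebra (LocalInt p) k] {n : ℕ}
    (hn : ¬ p ∣ n) : IsUnit (n : k) := by
  have h : IsUnit (algebraMap ℤ (LocalInt p) n) := by
    refine IsLocalization.map_units (M := (Ideal.span {(p : ℤ)}).primeCompl) (LocalInt p)
      ⟨(n : ℤ), ?_⟩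
    intro h
    exact hn (Int.natCast_dvd_natCast.1 (Ideal.mem_span_singleton.1 h))
  simpa using h.map (algebraMap (LocalInt p) k)

end LocalInt

/-! ### Powers of `p` suffice as denominators. -/

namespace LogRing

variable {p : ℕ} {k : Type w} [CommRing k]

/-- The elements that a power of `p` multiplies into `W`. -/
def denominators (W : Subalgebra k (LogRing.{v} p k)) : Subring (LogRing.{v} p k) where
  carrier := {x | ∃ N : ℕ, (p : LogRing.{v} p k) ^ N * x ∈ W}
  mul_mem' := by
    rintro x y ⟨N, hN⟩ ⟨M, hM⟩
    exact ⟨N + M, by rw [pow_add, mul_mul_mul_comm]; exact W.mul_mem hN hM⟩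
  one_mem' := ⟨0, by rw [pow_zero, one_mul]; exact W.one_mem⟩
  add_mem' := by
    rintro x y ⟨N, hN⟩ ⟨M, hM⟩
    have hpW (n : ℕ) : (p : LogRing.{v} p k) ^ n ∈ W := W.pow_mem (natCast_mem W p) n
    refine ⟨N + M, ?_⟩
    rw [mul_add, pow_add]
    refine W.add_mem ?_ ?_
    · rw [mul_comm (_ ^ N), mul_assoc]
      exact W.mul_mem (hpW M) hN
    · rw [mul_assoc]
      exact W.mul_mem (hpW N) hM
  zero_mem' := ⟨0, by rw [mul_zero]; exact W.zero_mem⟩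
  neg_mem' := by
    rintro x ⟨N, hN⟩
    exact ⟨N, by rw [mul_neg]; exact W.neg_mem hN⟩

theorem le_denominators {W : Subalgebra k (LogRing.{v} p k)} {x : LogRing.{v} p k} (hx : x ∈ W) :
    x ∈ denominators W :=
  ⟨0, by rwa [pow_zero, one_mul]⟩

variable [hp : Fact p.Prime] [Algebra (LocalInt p) k]
  {W : Subalgebra k (LogRing.{v} p k)}

/-- Write `n = p^e m` with `m` prime to `p`: then `m` is invertible already in `k`, and `p^e` is
absorbed into the denominator. -/
theorem mem_denominators_of_mul {x : LogRing.{v} p k} {n : ℕ} (hn : n ≠ 0)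
    (hx : (n : LogRing.{v} p k) * x ∈ denominators W) : x ∈ denominators W := by
  obtain ⟨e, m, hm, rfl⟩ := Nat.exists_eq_pow_mul_and_not_dvd hn p hp.out.ne_one
  obtain ⟨u, hu⟩ := (isUnit_natCast_of_not_dvd (k := k) hm).exists_left_inv
  have hu' : algebraMap k (LogRing.{v} p k) u * m = 1 := by
    rw [← map_natCast (algebraMap k (LogRing.{v} p k)), ← map_mul, hu, map_one]
  obtain ⟨N, hN⟩ := (denominators W).mul_mem (le_denominators (W.algebraMap_mem u)) hx
  refine ⟨N + e, ?_⟩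
  convert hN using 1
  push_cast
  linear_combination (-(p : LogRing.{v} p k) ^ N * (p : LogRing.{v} p k) ^ e * x) * hu'

theorem algebraMap_rat_mem_denominators (r : ℚ) :
    algebraMap ℚ (LogRing.{v} p k) r ∈ denominators W := by
  refine mem_denominators_of_mul r.den_ne_zero ?_
  rw [← map_natCast (algebraMap ℚ (LogRing.{v} p k)), ← map_mul, mul_comm, Rat.mul_den_eq_num,
    map_intCast]
  exact intCast_mem _ _

/-- The relation reads `p (p^(N+1) - 1) x = -s`, and this integer factor is nonzero, so it can be
divided out. -/
theorem mem_denominators_of_mul_sub {x s : LogRing.{v} p k} {N : ℕ} (hs : s ∈ denominators W)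
    (hx : s + x * (p : LogRing.{v} p k) ^ (N + 2) = p * x) : x ∈ denominators W := by
  have hp1 : 1 < p ^ (N + 1) := Nat.one_lt_pow (by omega) hp.out.one_lt
  have hne : p * (p ^ (N + 1) - 1) ≠ 0 := Nat.mul_ne_zero hp.out.ne_zero (by omega)
  refine mem_denominators_of_mul hne ?_
  have h : ((p * (p ^ (N + 1) - 1) : ℕ) : LogRing.{v} p k) * x = -s := by
    rw [Nat.cast_mul, Nat.cast_sub hp1.le, Nat.cast_pow, Nat.cast_one]
    linear_combination hx
  rw [h]
  exact neg_mem hs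

/-- Induction on the degree, solving `f([p](X)) = p f(X)` for one coefficient of `f` at a time. -/
theorem coeff_log_mem_denominators
    (hW : ∀ n, (isNormalized_log.{v} p k).lawSeries.coeff n ∈ W) (N : ℕ) :
    (log.{v} p k).coeff N ∈ denominators W := by
  have hf := isNormalized_log.{v} p k
  -- The law itself is defined over `W`, hence so are `[p](X)` and all of its powers.
  obtain ⟨F, hF⟩ := FormalGroup.exists_map_eq (φ := (W.val : W →+* LogRing.{v} p k))
    Subtype.val_injective hf.law fun n => ⟨⟨_, hW n⟩, rfl⟩
  obtain ⟨h, hh⟩ : ∃ h, h = F.multiplication p := ⟨_, rfl⟩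
  have h0 : PowerSeries.constantCoeff (h.map (W.val : W →+* LogRing.{v} p k)) = 0 := by
    rw [hh, FormalGroup.map_multiplication, FormalGroup.constantCoeff_multiplication]
  have hl : PowerSeries.subst (h.map (W.val : W →+* LogRing.{v} p k)) (log.{v} p k) =
      (p : LogRing.{v} p k) • log.{v} p k := by
    rw [hh, FormalGroup.map_multiplication, hF]
    exact FormalGroup.subst_multiplication hf hf.hasLog_law p
  have hc (n m : ℕ) : ((h.map (W.val : W →+* LogRing.{v} p k)) ^ m).coeff n ∈ W := by
    rw [← map_pow, PowerSeries.coeff_map]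
    exact ((h ^ m).coeff n).2
  have h1 : (h.map (W.val : W →+* LogRing.{v} p k)).coeff 1 = p := by
    have := congrArg (PowerSeries.coeff 1) hl
    rw [PowerSeries.coeff_subst_eq_sum h0, map_smul, coeff_log_one, Finset.sum_range_one,
      PowerSeries.coeff_zero_eq_constantCoeff_apply, hf.constantCoeff_eq, zero_mul, zero_add,
      one_mul, pow_one, smul_eq_mul, mul_one] at this
    exact this
  induction N using Nat.strong_induction_on with
  | _ N ih =>
    rcases N with _ | _ | N
    · rw [PowerSeries.coeff_zero_eq_constantCoeff_apply, hf.constantCoeff_eq]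
      exact zero_mem _
    · rw [zero_add, coeff_log_one]
      exact one_mem _
    -- In degree `N + 2` the top term is `ℓ p^(N+2)` and the right side `p ℓ`, with `ℓ` the
    -- coefficient sought. Degree `1` had to be split off, because there both sides cancel and
    -- nothing can be solved for.
    · have := congrArg (PowerSeries.coeff (N + 2)) hl
      rw [PowerSeries.coeff_subst_eq_sum h0, map_smul, h1, smul_eq_mul] at this
      exact mem_denominators_of_mul_sub (sum_mem fun m hm =>
        mul_mem (ih m (Finset.mem_range.1 hm)) (le_denominators (hc _ _))) this

/-- The universal logarithm has coefficients in `W[1/p]` if `W` contains the coefficients of the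
formal group law. -/
theorem exists_pow_mul_mem (hW : ∀ n, (isNormalized_log.{v} p k).lawSeries.coeff n ∈ W)
    (x : LogRing.{v} p k) : ∃ N : ℕ, (p : LogRing.{v} p k) ^ N * x ∈ W :=
  mem_of_subring (denominators W) (fun a => le_denominators (W.algebraMap_mem a))
    algebraMap_rat_mem_denominators
    (fun m => by rw [← coeff_log_of_mem]; exact coeff_log_mem_denominators hW m) x

end LogRing

/-! ### Rationalization -/

theorem IsAddTorsionFree.includeRight_injective (S : Type*) [CommRing S] [IsAddTorsionFree S] :
    Function.Injective (Algebra.TensorProduct.includeRight : S →ₐ[ℤ] ℚ ⊗[ℤ] S).toRingHom :=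
  Algebra.TensorProduct.includeRight_injective (algebraMap ℤ ℚ).injective_int

/-- Finitely many rational coefficients have a common denominator. -/
theorem exists_natCast_mul_eq_includeRight {S : Type*} [CommRing S] (z : ℚ ⊗[ℤ] S) :
    ∃ (n : ℕ) (s : S), n ≠ 0 ∧ (n : ℚ ⊗[ℤ] S) * z = 1 ⊗ₜ s := by
  induction z with
  | zero => exact ⟨1, 0, one_ne_zero, by simp⟩
  | tmul r s =>
    refine ⟨r.den, r.num • s, r.den_ne_zero, ?_⟩
    rw [← nsmul_eq_mul, TensorProduct.tmul_smul, TensorProduct.smul_tmul', TensorProduct.smul_tmul']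
    congr 1
    rw [nsmul_eq_mul, zsmul_eq_mul, mul_one, mul_comm, Rat.mul_den_eq_num]
  | add y z hy hz =>
    obtain ⟨n, s, hn, hs⟩ := hy
    obtain ⟨m, t, hm, ht⟩ := hz
    refine ⟨n * m, m • s + n • t, mul_ne_zero hn hm, ?_⟩
    rw [TensorProduct.tmul_add, TensorProduct.tmul_smul, TensorProduct.tmul_smul, ← hs, ← ht,
      nsmul_eq_mul, nsmul_eq_mul]
    push_cast
    ring

theorem isUnit_natCast_of_algebra_rat (R : Type*) [CommRing R] [Algebra ℚ R] {n : ℕ} (hn : n ≠ 0) :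
    IsUnit (n : R) := by
  simpa using (IsUnit.mk0 (n : ℚ) (by exact_mod_cast hn)).map (algebraMap ℚ R)

/-- A `ℚ`-algebra that consists of fractions of a subring is the rationalization of the subring. -/
theorem exists_ringEquiv_rat_tensor {R Q : Type*} [CommRing R] [CommRing Q] [Algebra ℚ Q]
    {φ : R →+* Q} (hφ : Function.Injective φ) (h : ∀ x, ∃ n : ℕ, n ≠ 0 ∧ (n : Q) * x ∈ φ.range) :
    ∃ ψ : ℚ ⊗[ℤ] R ≃+* Q, ∀ r, ψ (1 ⊗ₜ r) = φ r := by
  let ψ : ℚ ⊗[ℤ] R →ₐ[ℤ] Q := Algebra.TensorProduct.lift ((Algebra.ofId ℚ Q).restrictScalars ℤ)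
    φ.toIntAlgHom fun _ _ => Commute.all _ _
  have hψ (r : R) : ψ (1 ⊗ₜ r) = φ r := by simp [ψ]
  have hbij : Function.Bijective ψ.toRingHom := by
    refine ⟨(injective_iff_map_eq_zero _).2 fun z hz => ?_, fun x => ?_⟩
    · obtain ⟨n, s, hn, hs⟩ := exists_natCast_mul_eq_includeRight z
      have h0 : φ s = 0 := by
        rw [← hψ, ← hs, map_mul]
        exact mul_eq_zero_of_right _ hz
      rw [(map_eq_zero_iff φ hφ).1 h0, TensorProduct.tmul_zero] at hs
      exact (isUnit_natCast_of_algebra_rat _ hn).mul_right_eq_zero.1 hs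
    · obtain ⟨n, hn, r, hr⟩ := h x
      obtain ⟨u, hu⟩ := (isUnit_natCast_of_algebra_rat (ℚ ⊗[ℤ] R) hn).exists_left_inv
      refine ⟨u * 1 ⊗ₜ r, ?_⟩
      have hu' : ψ u * n = 1 := by rw [← map_natCast ψ, ← map_mul, hu, map_one]
      change ψ (u * 1 ⊗ₜ r) = x
      rw [map_mul, hψ, hr, ← mul_assoc, hu', one_mul]
  exact ⟨RingEquiv.ofBijective ψ.toRingHom hbij, hψ⟩

/-- A logarithm may be exhibited over any `ℚ`-algebra of fractions of `R`, since that algebra is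
isomorphic to `ℚ ⊗ R` compatibly with `R`. -/
theorem FormalGroup.hasTypicalLog_of_map {R Q : Type*} [CommRing R] [CommRing Q] [Algebra ℚ Q]
    {φ : R →+* Q} (hφ : Function.Injective φ) (h : ∀ x, ∃ n : ℕ, n ≠ 0 ∧ (n : Q) * x ∈ φ.range)
    {q : ℕ} {F : FormalGroup R} {f : PowerSeries Q} (h1 : f.coeff 1 = 1)
    (hf : ∀ k : ℕ, (∀ n : ℕ, k ≠ q ^ n) → f.coeff k = 0)
    (hl : (F.map φ).toPowerSeries.HasLog f) : F.HasTypicalLog q := by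
  obtain ⟨ψ, hψ⟩ := exists_ringEquiv_rat_tensor hφ h
  refine FormalGroup.hasTypicalLog_iff.2 ⟨f.map (ψ.symm : Q →+* ℚ ⊗[ℤ] R), ?_, ?_, ?_⟩
  · rw [PowerSeries.coeff_map, h1, map_one]
  · intro k hk
    rw [PowerSeries.coeff_map, hf k hk, map_zero]
  · have := hl.map (ψ.symm : Q →+* ℚ ⊗[ℤ] R) (F.map φ).zero_constantCoeff
    convert this using 1
    change _ = ((F.map φ).map (ψ.symm : Q →+* ℚ ⊗[ℤ] R)).toPowerSeries
    rw [FormalGroup.map_map]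
    congr 2
    ext r
    exact (ψ.symm_apply_eq.2 (hψ r).symm).symm

/-! ### Functoriality in the logarithm -/

namespace PowerSeries.IsNormalized

variable {R S : Type*} [CommRing R] [CommRing S] {f : PowerSeries R} (hf : f.IsNormalized)

theorem map_law (φ : R →+* S) : hf.law.map φ = (hf.map φ).law :=
  FormalGroup.ext <| MvPowerSeries.HasLog.eq (hf.map φ) (hf.law.map φ).zero_constantCoeff
    (hf.map φ).law.zero_constantCoeff (hf.hasLog_law.map φ hf.law.zero_constantCoeff)
    (hf.map φ).hasLog_law

theorem map_actSeries (φ : R →+* S) (r : R) :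
    (hf.actSeries r).map φ = (hf.map φ).actSeries (φ r) := by
  have h0 := hf.constantCoeff_actSeries r
  have h1 : constantCoeff ((hf.actSeries r).map φ) = 0 := by
    rw [← coeff_zero_eq_constantCoeff_apply, coeff_map, coeff_zero_eq_constantCoeff_apply, h0,
      map_zero]
  refine (hf.map φ).subst_injective h1 ((hf.map φ).constantCoeff_actSeries _) ?_
  rw [(hf.map φ).subst_actSeries]
  refine (PowerSeries.map_subst (.of_constantCoeff_zero h0) f).symm.trans ?_
  rw [hf.subst_actSeries]
  change PowerSeries.map φ (r • f) = _
  ext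
  simp

theorem eq_law {F : FormalGroup R} (h : F.toPowerSeries.HasLog f) : F = hf.law :=
  FormalGroup.ext <| MvPowerSeries.HasLog.eq hf F.zero_constantCoeff hf.law.zero_constantCoeff h
    hf.hasLog_law

end PowerSeries.IsNormalized

/-- Each `ρ(a)` is an endomorphism with linear coefficient `a`, so over a `ℚ`-algebra `f ∘ ρ(a) = a
f`. The action thus carries no information beyond the law and the structure map. -/
theorem FormalModule.map_act_eq_actSeries {A R Q : Type*} [CommRing A] [CommRing R] [CommRing Q]
    [Algebra A R] [Algebra ℚ Q] (φ : R →+* Q) (F : FormalModule A R) {f : PowerSeries Q}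
    (hf : f.IsNormalized) (hl : (F.toFormalGroup.map φ).toPowerSeries.HasLog f) (a : A) :
    (F.act a).map φ = hf.actSeries (φ (algebraMap A R a)) := by
  have h0 : MvPowerSeries.constantCoeff (F.act a) = 0 := F.constantCoeff_act a
  have h0' : PowerSeries.constantCoeff ((F.act a).map φ) = 0 := by
    rw [← PowerSeries.coeff_zero_eq_constantCoeff_apply, PowerSeries.coeff_map, F.act_coeff_zero,
      map_zero]
  have hX (i : Fin 2) : MvPowerSeries.constantCoeff
      (PowerSeries.subst (MvPowerSeries.X i : MvPowerSeries (Fin 2) R) (F.act a)) = 0 :=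
    PowerSeries.constantCoeff_subst_eq_zero (MvPowerSeries.constantCoeff_X i) _ h0
  refine hf.subst_injective h0' (hf.constantCoeff_actSeries _) ?_
  rw [hf.subst_actSeries, hf.subst_endomorphism (F.toFormalGroup.map φ).zero_constantCoeff hl h0',
    PowerSeries.coeff_map, F.act_coeff_one]
  have h := congrArg (MvPowerSeries.map φ) (F.act_endo a)
  rwa [PowerSeries.map_subst (.of_constantCoeff_zero F.zero_constantCoeff),
    MvPowerSeries.map_subst_pair _ (hX _) (hX _), PowerSeries.map_subst (.X _),
    PowerSeries.map_subst (.X _), MvPowerSeries.map_X, MvPowerSeries.map_X] at h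

/-! ### Subalgebras generated by coefficients -/

section Adjoin

variable {k P S Q : Type*} [CommRing k] [CommRing P] [CommRing S] [CommRing Q] [Algebra k P]
  [Algebra k S]

/-- If `Φ` sends generators and constants into the subring `S` of `Q`, it sends everything they
generate there. This cuts maps out of `LogRing` down to maps between classifying rings. -/
theorem Algebra.exists_algHom_adjoin {T : Set P} (Φ : P →+* Q) {ι : S →+* Q}
    (hι : Function.Injective ι) (hk : ∀ a, Φ (algebraMap k P a) = ι (algebraMap k S a))
    (hT : ∀ t ∈ T, Φ t ∈ ι.range) :
    ∃ χ : Algebra.adjoin k T →ₐ[k] S, ∀ x, ι (χ x) = Φ x := by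
  have h (x : Algebra.adjoin k T) : Φ x ∈ ι.range := by
    obtain ⟨x, hx⟩ := x
    induction hx using Algebra.adjoin_induction with
    | mem t ht => exact hT t ht
    | algebraMap a => exact ⟨_, (hk a).symm⟩
    | add x y _ _ hx hy => simpa using add_mem hx hy
    | mul x y _ _ hx hy => simpa using mul_mem hx hy
  choose c hc using h
  refine ⟨{ toFun := c, map_one' := hι ?_, map_mul' := fun x y => hι ?_, map_zero' := hι ?_
            map_add' := fun x y => hι ?_
            commutes' := fun _ => hι ?_ }, hc⟩
  · rw [hc, map_one]; exact map_one Φ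
  · rw [map_mul, hc, hc, hc, ← map_mul]; rfl
  · rw [hc, map_zero]; exact map_zero Φ
  · rw [map_add, hc, hc, hc, ← map_add]; rfl
  · rw [hc, ← hk]; rfl

theorem Algebra.adjoin_eq_top_of_injective {ι : S →ₐ[k] P} (hι : Function.Injective ι) {s : Set S}
    (h : ∀ x, ι x ∈ Algebra.adjoin k (ι '' s)) : Algebra.adjoin k s = ⊤ := by
  refine Algebra.eq_top_iff.2 fun x => ?_
  have hx := h x
  rw [← AlgHom.map_adjoin] at hx
  obtain ⟨y, hy, hyx⟩ := hx
  rwa [← hι hyx]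

end Adjoin

/-! ### The universal typical formal group law -/

/-- A typical logarithm over `ℚ ⊗ S` is the image of the universal one. -/
theorem LogRing.exists_map_log_eq {q : ℕ} (hq : q ≠ 0) {k : Type w} [CommRing k]
    {S : Type*} [CommRing S] [Algebra k S] {G : FormalGroup S} (hG : G.HasTypicalLog q) :
    ∃ Φ : LogRing.{v} q k →+* ℚ ⊗[ℤ] S,
      (∀ a, Φ (algebraMap k _ a) = Algebra.TensorProduct.includeRight (algebraMap k S a)) ∧
      (isNormalized_log.{v} q k).law.map Φ = G.map
        (Algebra.TensorProduct.includeRight : S →ₐ[ℤ] ℚ ⊗[ℤ] S).toRingHom ∧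
      (G.map (Algebra.TensorProduct.includeRight : S →ₐ[ℤ] ℚ ⊗[ℤ] S).toRingHom).toPowerSeries.HasLog
        ((log.{v} q k).map Φ) := by
  obtain ⟨f, h1, hf, hl⟩ := FormalGroup.hasTypicalLog_iff.1 hG
  let Φ : LogRing.{v} q k →+* ℚ ⊗[ℤ] S := lift
    ((Algebra.TensorProduct.includeRight : S →ₐ[ℤ] ℚ ⊗[ℤ] S).toRingHom.comp (algebraMap k S))
    fun m => f.coeff m
  have hΦ : (log.{v} q k).map Φ = f := map_log_lift hq _ h1 hf
  refine ⟨Φ, fun a => lift_algebraMap _ _ a, ?_, hΦ ▸ hl⟩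
  rw [PowerSeries.IsNormalized.map_law]
  exact (PowerSeries.IsNormalized.eq_law _ (hΦ ▸ hl)).symm

/-- Typicality asks for a logarithm over `ℚ ⊗ W`, while the universal one lives over `LogRing p k`.
The two rings agree because each element of the latter is an element of `W` divided by a power of
`p`. -/
theorem LogRing.hasTypicalLog {p : ℕ} [hp : Fact p.Prime] {k : Type w} [CommRing k]
    [Algebra (LocalInt p) k] {W : Subalgebra k (LogRing.{v} p k)}
    {G : FormalGroup W} (hG : G.map (W.val : W →+* LogRing.{v} p k) = (isNormalized_log p k).law) :
    G.HasTypicalLog p := by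
  refine FormalGroup.hasTypicalLog_of_map (φ := (W.val : W →+* LogRing.{v} p k))
    Subtype.val_injective (fun x => ?_) (coeff_log_one k) (fun m => coeff_log_eq_zero k)
    (hG ▸ (isNormalized_log p k).hasLog_law)
  obtain ⟨N, hN⟩ := exists_pow_mul_mem (W := W) (fun n => by
    change (isNormalized_log.{v} p k).law.toPowerSeries.coeff n ∈ W
    rw [← hG, FormalGroup.coeff_map]
    exact (G.toPowerSeries.coeff n).2) x
  exact ⟨p ^ N, pow_ne_zero N hp.out.ne_zero, ⟨_, hN⟩, by push_cast; rfl⟩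

namespace FormalGroup

/-- Homomorphisms from a ring that is generated by the coefficients of `F` are determined by the
image of `F`. -/
theorem algHom_ext {k R S : Type*} [CommRing k] [CommRing R] [CommRing S] [Algebra k R]
    [Algebra k S] {F : FormalGroup R} (hF : Algebra.adjoin k (⋃ d, F.coeffsOfDegree d) = ⊤)
    {φ ψ : R →ₐ[k] S} (h : F.map (φ : R →+* S) = F.map (ψ : R →+* S)) : φ = ψ := by
  refine AlgHom.ext_of_adjoin_eq_top hF ?_
  rintro x hx
  obtain ⟨d, i, j, -, rfl⟩ := Set.mem_iUnion.1 hx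
  have := congrArg (fun G => G.toPowerSeries.coeff (Finsupp.single 0 i + Finsupp.single 1 j)) h
  rwa [coeff_map, coeff_map] at this

variable (p : ℕ) [hp : Fact p.Prime] (k : Type w) [CommRing k] [Algebra (LocalInt p) k]

/-- The universal `p`-typical formal group law exists, and its classifying ring embeds into the
ring that carries the universal logarithm. -/
theorem exists_isUniversalTypical : ∃ (W : Subalgebra k (LogRing.{v} p k)) (G : FormalGroup W),
    G.map (W.val : W →+* LogRing.{v} p k) = (LogRing.isNormalized_log p k).law ∧
    Algebra.adjoin k (⋃ d, G.coeffsOfDegree d) = ⊤ ∧ G.IsUniversalTypical k p := by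
  obtain ⟨L, hL⟩ : ∃ L, L = (LogRing.isNormalized_log.{v} p k).law := ⟨_, rfl⟩
  rw [← hL]
  let W := Algebra.adjoin k (⋃ d, L.coeffsOfDegree d)
  have hLW (d) : L.coeffsOfDegree d ⊆ W := (Set.subset_iUnion _ d).trans Algebra.subset_adjoin
  obtain ⟨G, hG⟩ := exists_map_eq (φ := (W.val : W →+* LogRing.{v} p k)) Subtype.val_injective L
    fun n => ⟨⟨_, coeff_mem W.zero_mem hLW n⟩, rfl⟩
  have htop : Algebra.adjoin k (⋃ d, G.coeffsOfDegree d) = ⊤ := by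
    refine Algebra.adjoin_eq_top_of_injective (ι := W.val) Subtype.val_injective fun x => ?_
    have hi (d : ℕ) : W.val '' G.coeffsOfDegree d = L.coeffsOfDegree d := by
      rw [← hG, ← image_coeffsOfDegree]
      rfl
    simp_rw [Set.image_iUnion, hi]
    exact x.2
  refine ⟨W, G, hG, htop, ⟨W, inferInstance, inferInstance, G, AlgHom.id k W, ?_,
    LogRing.hasTypicalLog (hG.trans hL), G.map_id⟩, ?_⟩
  · exact Function.Injective.isAddTorsionFree W.val.toRingHom.toAddMonoidHom Subtype.val_injective
  -- It suffices to classify the lift `G'` over the torsion-free `S`, which embeds into `ℚ ⊗ S`, and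
  -- then to compose with `φ`. Uniqueness over `R` does not involve the lift.
  · rintro R _ _ H ⟨S, _, _, G', φ, hS, hG', rfl⟩
    obtain ⟨Φ, hΦk, hΦ, -⟩ := LogRing.exists_map_log_eq.{v} (k := k) hp.out.ne_zero hG'
    rw [← hL] at hΦ
    have hinj := IsAddTorsionFree.includeRight_injective S
    obtain ⟨χ, hχ⟩ := Algebra.exists_algHom_adjoin (S := S) Φ hinj hΦk
      (T := ⋃ d, L.coeffsOfDegree d) (by
        intro t ht
        obtain ⟨d, i, j, -, rfl⟩ := Set.mem_iUnion.1 ht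
        rw [← coeff_map, hΦ, coeff_map]
        exact ⟨_, rfl⟩)
    have hχG : G.map (χ : W →+* S) = G' := by
      apply FormalGroup.ext
      apply MvPowerSeries.map_injective hinj
      refine Eq.trans ?_ (congrArg toPowerSeries ((congrArg (fun F => F.map Φ) hG).trans hΦ))
      ext n
      rw [map_map, map_toPowerSeries, map_toPowerSeries, MvPowerSeries.coeff_map,
        MvPowerSeries.coeff_map, MvPowerSeries.coeff_map]
      exact hχ _
    refine ⟨φ.comp χ, ?_, fun χ' hχ' => algHom_ext htop ?_⟩
    · rw [← hχG, map_map]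
      rfl
    · rw [hχ', ← hχG, map_map]
      rfl

variable {p k}

/-- Any classifying ring of `p`-typical formal group laws embeds into the ring that carries the
universal logarithm, and is generated by the coefficients. -/
theorem IsUniversalTypical.exists_algHom_logRing {V : Type (max v w)} [CommRing V] [Algebra k V]
    {F : FormalGroup V} (hF : F.IsUniversalTypical k p) :
    ∃ ι : V →ₐ[k] LogRing.{v} p k, Function.Injective ι ∧
      F.map (ι : V →+* LogRing.{v} p k) = (LogRing.isNormalized_log p k).law ∧
      Algebra.adjoin k (⋃ d, F.coeffsOfDegree d) = ⊤ := by
  obtain ⟨W, G, hG, htop, hGu⟩ := exists_isUniversalTypical.{v} p k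
  obtain ⟨α, hα, -⟩ := hF.2 W G hGu.1
  obtain ⟨β, hβ, -⟩ := hGu.2 V F hF.1
  -- Both maps classify `F` over `V` itself. This one-sided inverse is all that injectivity of `α`
  -- needs.
  have hβα : β.comp α = AlgHom.id k V := (hF.2 V F hF.1).unique
    ((map_map F _ _).symm.trans (by rw [hα]; exact hβ)) F.map_id
  have hι : Function.Injective (W.val.comp α) := by
    refine Function.Injective.comp (g := W.val) Subtype.val_injective ?_
    exact Function.LeftInverse.injective (g := β) fun x => DFunLike.congr_fun hβα x
  refine ⟨W.val.comp α, hι, ?_, ?_⟩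
  · rw [← hG, ← hα, map_map]
    rfl
  · refine Algebra.adjoin_eq_top_of_injective (ι := α)
      (Function.LeftInverse.injective (g := β) fun x => DFunLike.congr_fun hβα x) fun x => ?_
    have hi (d : ℕ) : α '' F.coeffsOfDegree d = G.coeffsOfDegree d := by
      rw [← hα, ← image_coeffsOfDegree]
      rfl
    simp_rw [Set.image_iUnion, hi, htop]
    trivial

end FormalGroup

/-! ### The universal typical formal module -/

namespace FormalModule

/-- Homomorphisms from a ring that is generated by the coefficients of `F` are determined by the
image of `F`. -/
theorem algHom_ext {A R S : Type*} [CommRing A] [CommRing R] [CommRing S] [Algebra A R]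
    [Algebra A S] {F : FormalModule A R} (hF : Algebra.adjoin A (⋃ d, F.coeffsOfDegree d) = ⊤)
    {G : FormalModule A S} {φ ψ : R →ₐ[A] S} (hφ : F.IsPushforward φ G)
    (hψ : F.IsPushforward ψ G) : φ = ψ := by
  refine AlgHom.ext_of_adjoin_eq_top hF ?_
  rintro x hx
  obtain ⟨d, ⟨i, j, -, rfl⟩ | ⟨a, i, -, rfl⟩⟩ := Set.mem_iUnion.1 hx
  · have := congrArg (fun G => G.toPowerSeries.coeff (Finsupp.single 0 i + Finsupp.single 1 j))
      (hφ.1.trans hψ.1.symm)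
    rwa [FormalGroup.coeff_map, FormalGroup.coeff_map] at this
  · have := congrArg (PowerSeries.coeff i) ((hφ.2 a).trans (hψ.2 a).symm)
    rwa [PowerSeries.coeff_map, PowerSeries.coeff_map] at this

/-- The inclusion of the subalgebra generated by the coefficients is injective on formal modules. -/
theorem IsPushforward.of_comp {A R S Q : Type*} [CommRing A] [CommRing R] [CommRing S] [CommRing Q]
    [Algebra A R] [Algebra A S] {ι : S →+* Q} (hι : Function.Injective ι) {F : FormalModule A R}
    {G : FormalModule A S} {χ : R →ₐ[A] S}
    (h : F.toFormalGroup.map (ι.comp (χ : R →+* S)) = G.toFormalGroup.map ι)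
    (h' : ∀ a, (F.act a).map (ι.comp (χ : R →+* S)) = (G.act a).map ι) : F.IsPushforward χ G := by
  refine ⟨FormalGroup.ext (MvPowerSeries.map_injective hι ?_), fun a => ?_⟩
  · have := congrArg FormalGroup.toPowerSeries h
    rwa [← FormalGroup.map_map] at this
  · ext n
    have := congrArg (PowerSeries.coeff n) (h' a)
    rw [PowerSeries.coeff_map, PowerSeries.coeff_map] at this
    rw [PowerSeries.coeff_map]
    exact hι this

variable (p : ℕ) [hp : Fact p.Prime] (A : Type w) [CommRing A] [Algebra (LocalInt p) A]

/-- The universal `p`-typical formal `A`-module exists, and its classifying ring embeds into the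
ring that carries the universal logarithm. -/
theorem exists_isUniversalTypical :
    ∃ (W : Subalgebra A (LogRing.{v} p A)) (G : FormalModule A W),
      G.IsPushforward W.val ((LogRing.isNormalized_log p A).formalModule A) ∧
      Algebra.adjoin A (⋃ d, G.coeffsOfDegree d) = ⊤ ∧ G.IsUniversalTypical p := by
  obtain ⟨L, hL⟩ : ∃ L, L = (LogRing.isNormalized_log.{v} p A).formalModule A := ⟨_, rfl⟩
  have hLlaw : L.toFormalGroup = (LogRing.isNormalized_log.{v} p A).law := hL ▸ rfl
  have hLact (a : A) : L.act a =
      (LogRing.isNormalized_log.{v} p A).actSeries (algebraMap A _ a) := hL ▸ rfl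
  rw [← hL]
  let W := Algebra.adjoin A (⋃ d, L.coeffsOfDegree d)
  have hLW (d) : L.coeffsOfDegree d ⊆ W := (Set.subset_iUnion _ d).trans Algebra.subset_adjoin
  obtain ⟨G, hG⟩ := exists_isPushforward (φ := W.val) Subtype.val_injective L
    (fun n => ⟨⟨_, FormalGroup.coeff_mem (F := L.toFormalGroup) W.zero_mem
      (fun d => Set.subset_union_left.trans (hLW d)) n⟩, rfl⟩)
    (fun a n => ⟨⟨_, act_coeff_mem W.zero_mem hLW a n⟩, rfl⟩)
  have htop : Algebra.adjoin A (⋃ d, G.coeffsOfDegree d) = ⊤ := by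
    refine Algebra.adjoin_eq_top_of_injective (ι := W.val) Subtype.val_injective fun x => ?_
    simp_rw [Set.image_iUnion, image_coeffsOfDegree hG]
    exact x.2
  refine ⟨W, G, hG, htop, ⟨W, inferInstance, inferInstance, G, AlgHom.id A W, ?_,
    LogRing.hasTypicalLog (hG.1.trans hLlaw), .refl G⟩, ?_⟩
  · exact Function.Injective.isAddTorsionFree W.val.toRingHom.toAddMonoidHom Subtype.val_injective
  · rintro R _ _ H ⟨S, _, _, G', φ, hS, hG', hH⟩
    obtain ⟨Φ, hΦk, hΦ, hl⟩ :=
      LogRing.exists_map_log_eq.{v} (k := A) hp.out.ne_zero hG'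
    rw [← hLlaw] at hΦ
    have hinj := IsAddTorsionFree.includeRight_injective S
    -- `Φ` was chosen to match the law only; compatibility with the action follows, as the logarithm
    -- determines it.
    have hΦa (a : A) : (L.act a).map Φ = (G'.act a).map
        (Algebra.TensorProduct.includeRight : S →ₐ[ℤ] ℚ ⊗[ℤ] S).toRingHom := by
      rw [map_act_eq_actSeries _ G' ((LogRing.isNormalized_log p A).map Φ) hl, hLact,
        PowerSeries.IsNormalized.map_actSeries, hΦk]
      rfl
    obtain ⟨χ, hχ⟩ := Algebra.exists_algHom_adjoin (S := S) Φ hinj hΦk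
      (T := ⋃ d, L.coeffsOfDegree d) (by
        intro t ht
        obtain ⟨d, ⟨i, j, -, rfl⟩ | ⟨a, i, -, rfl⟩⟩ := Set.mem_iUnion.1 ht
        · rw [← FormalGroup.coeff_map, hΦ, FormalGroup.coeff_map]
          exact ⟨_, rfl⟩
        · rw [← PowerSeries.coeff_map, hΦa, PowerSeries.coeff_map]
          exact ⟨_, rfl⟩)
    have hcomp : (Algebra.TensorProduct.includeRight : S →ₐ[ℤ] ℚ ⊗[ℤ] S).toRingHom.comp
        (χ : W →+* S) = Φ.comp (W.val : W →+* LogRing.{v} p A) := RingHom.ext hχ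
    have hχG : G.IsPushforward χ G' := by
      refine IsPushforward.of_comp hinj ?_ fun a => ?_
      · rw [hcomp, ← FormalGroup.map_map, hG.1, hΦ]
      · rw [hcomp, ← hΦa, ← hG.2 a]
        ext
        simp
    exact ⟨φ.comp χ, hχG.trans hH, fun χ' hχ' => algHom_ext htop hχ' (hχG.trans hH)⟩

variable {p A}

/-- Any classifying ring of `p`-typical formal `A`-modules embeds into the ring that carries the
universal logarithm, and is generated by the coefficients. -/
theorem IsUniversalTypical.exists_algHom_logRing {V : Type (max v w)} [CommRing V] [Algebra A V]
    {F : FormalModule A V} (hF : F.IsUniversalTypical p) :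
    ∃ ι : V →ₐ[A] LogRing.{v} p A, Function.Injective ι ∧
      F.IsPushforward ι ((LogRing.isNormalized_log p A).formalModule A) ∧
      Algebra.adjoin A (⋃ d, F.coeffsOfDegree d) = ⊤ := by
  obtain ⟨W, G, hG, htop, hGu⟩ := exists_isUniversalTypical.{v} p A
  obtain ⟨α, hα, -⟩ := hF.2 W G hGu.1
  obtain ⟨β, hβ, -⟩ := hGu.2 V F hF.1
  have hβα : β.comp α = AlgHom.id A V := (hF.2 V F hF.1).unique (hα.trans hβ) (.refl F)
  have hα' : Function.Injective α :=
    Function.LeftInverse.injective (g := β) fun x => DFunLike.congr_fun hβα x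
  refine ⟨W.val.comp α, Function.Injective.comp (g := W.val) Subtype.val_injective hα',
    hα.trans hG, Algebra.adjoin_eq_top_of_injective hα' fun x => ?_⟩
  simp_rw [Set.image_iUnion, image_coeffsOfDegree hα, htop]
  trivial

end FormalModule

/-! ### Gradings -/

section weightPiece

variable {k R : Type*} [CommRing k] [CommRing R] [Algebra k R] {C : ℕ → Set R}

theorem subset_weightPiece (d : ℕ) : C d ⊆ weightPiece k C d := fun x hx =>
  Submodule.subset_span ⟨[(d, x)], by simpa using hx, by simp, by simp⟩

theorem one_mem_weightPiece : (1 : R) ∈ weightPiece k C 0 :=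
  Submodule.subset_span ⟨[], by simp, by simp, by simp⟩

theorem mul_mem_weightPiece {d e : ℕ} {x y : R} (hx : x ∈ weightPiece k C d)
    (hy : y ∈ weightPiece k C e) : x * y ∈ weightPiece k C (d + e) := by
  have h := Submodule.mul_mem_mul hx hy
  rw [weightPiece, weightPiece, Submodule.span_mul_span] at h
  refine Submodule.span_mono ?_ h
  rintro _ ⟨_, ⟨l, hl, rfl, rfl⟩, _, ⟨l', hl', rfl, rfl⟩, rfl⟩
  refine ⟨l ++ l', fun c hc => ?_, by simp, by simp⟩
  exact (List.mem_append.1 hc).elim (hl c) (hl' c)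

/-- The pieces `weightPiece k C` are the smallest multiplicative family of submodules that contains
the `C d` and has `1` in degree `0`. -/
theorem weightPiece_le {D : ℕ → Submodule k R} (h1 : 1 ∈ D 0)
    (hmul : ∀ {d e : ℕ} {x y : R}, x ∈ D d → y ∈ D e → x * y ∈ D (d + e)) (hC : ∀ d, C d ⊆ D d)
    (d : ℕ) : weightPiece k C d ≤ D d := by
  refine Submodule.span_le.2 ?_
  rintro _ ⟨l, hl, rfl, rfl⟩
  induction l with
  | nil => simpa using h1
  | cons c l ih =>
    rw [List.map_cons, List.map_cons, List.sum_cons, List.prod_cons]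
    exact hmul (hC _ (hl c (by simp))) (ih fun c' hc' => hl c' (by simp [hc']))

instance gradedMonoid_weightPiece : SetLike.GradedMonoid (weightPiece k C) where
  one_mem := one_mem_weightPiece
  mul_mem _ _ _ _ := mul_mem_weightPiece

theorem iSup_weightPiece (hC : Algebra.adjoin k (⋃ d, C d) = ⊤) :
    ⨆ d, weightPiece k C d = ⊤ := by
  refine Submodule.eq_top_iff'.2 fun x => ?_
  have hx : x ∈ Algebra.adjoin k (⋃ d, C d) := hC ▸ trivial
  induction hx using Algebra.adjoin_induction with
  | mem x hx =>
    obtain ⟨d, hd⟩ := Set.mem_iUnion.1 hx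
    exact Submodule.mem_iSup_of_mem d (subset_weightPiece d hd)
  | algebraMap a =>
    rw [Algebra.algebraMap_eq_smul_one]
    exact Submodule.smul_mem _ _ (Submodule.mem_iSup_of_mem 0 one_mem_weightPiece)
  | add x y _ _ hx hy => exact add_mem hx hy
  | mul x y hxa hya hx hy =>
    clear hxa hya
    induction hx using Submodule.iSup_induction' with
    | zero => rw [zero_mul]; exact zero_mem _
    | add x x' _ _ hx hx' => rw [add_mul]; exact add_mem hx hx'
    | mem d x hx =>
      induction hy using Submodule.iSup_induction' with
      | zero => rw [mul_zero]; exact zero_mem _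
      | add y y' _ _ hy hy' => rw [mul_add]; exact add_mem hy hy'
      | mem e y hy => exact Submodule.mem_iSup_of_mem (d + e) (mul_mem_weightPiece hx hy)

/-- Generators in the sets `C d` define a grading if a homomorphism to polynomials in `T` multiplies
the elements of `C d` with `T ^ d`. -/
theorem nonempty_gradedAlgebra_weightPiece (hC : Algebra.adjoin k (⋃ d, C d) = ⊤)
    {P : Type*} [CommRing P] [Algebra k P] {ι : R →ₐ[k] P} (hι : Function.Injective ι)
    (δ : P →+* Polynomial P) (hk : ∀ a, δ (algebraMap k P a) = Polynomial.C (algebraMap k P a))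
    (hδ : ∀ d, ∀ x ∈ C d, δ (ι x) = Polynomial.monomial d (ι x)) :
    Nonempty (GradedAlgebra (weightPiece k C)) := by
  -- The eigenspaces of the coaction `δ`: `D d` consists of the elements that `δ` multiplies by `T ^
  -- d`. They contain the weight pieces.
  let D (d : ℕ) : Submodule k R :=
    { carrier := {x | δ (ι x) = Polynomial.monomial d (ι x)}
      add_mem' := fun {x y} hx hy => by
        rw [Set.mem_ofPred_eq] at hx hy ⊢
        rw [map_add, map_add, hx, hy, map_add]
      zero_mem' := by simp
      smul_mem' := fun a x hx => by
        rw [Set.mem_ofPred_eq] at hx ⊢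
        rw [Algebra.smul_def, map_mul, AlgHom.commutes, map_mul, hk, hx,
          Polynomial.C_mul_monomial] }
  have hD (d : ℕ) (x : R) : x ∈ D d ↔ δ (ι x) = Polynomial.monomial d (ι x) := Iff.rfl
  have hle := weightPiece_le (C := C) (D := D) (by simp [hD])
    (fun {d e x y} hx hy => by
      rw [hD] at hx hy ⊢
      rw [map_mul, map_mul, hx, hy, Polynomial.monomial_mul_monomial]) hδ
  -- Reading off the coefficient of `T ^ d` recovers the `d`-th component of a sum, so the sum of
  -- the pieces is direct.
  have hcoeff (z : DirectSum ℕ fun d => weightPiece k C d) (d : ℕ) :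
      (δ (ι (DirectSum.coeAddMonoidHom (weightPiece k C) z))).coeff d = ι (z d) := by
    induction z using DirectSum.induction_on with
    | zero => simp
    | of e x =>
      rw [DirectSum.coeAddMonoidHom_of, (hD e _).1 (hle e x.2), Polynomial.coeff_monomial,
        DirectSum.coe_of_apply]
      split_ifs <;> simp
    | add y z hy hz =>
      rw [map_add, map_add, map_add, Polynomial.coeff_add, hy, hz, ← map_add]
      rfl
  have hint : DirectSum.IsInternal (weightPiece k C) := by
    refine ⟨(injective_iff_map_eq_zero _).2 fun z hz => ?_, fun x => ?_⟩
    · ext d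
      apply hι
      rw [← hcoeff, hz]
      simp
    · have hx : x ∈ ⨆ d, weightPiece k C d := iSup_weightPiece hC ▸ trivial
      induction hx using Submodule.iSup_induction' with
      | mem d x hx => exact ⟨DirectSum.of _ d ⟨x, hx⟩, DirectSum.coeAddMonoidHom_of _ d ⟨x, hx⟩⟩
      | zero => exact ⟨0, map_zero _⟩
      | add x y _ _ hx hy =>
        obtain ⟨z, rfl⟩ := hx
        obtain ⟨w, rfl⟩ := hy
        exact ⟨z + w, map_add _ z w⟩
  exact ⟨{ toGradedMonoid := inferInstance, toDecomposition := hint.chooseDecomposition }⟩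

end weightPiece

/-! ### The weights of the coefficients -/

namespace PowerSeries.IsNormalized

variable {R Q : Type*} [CommRing R] [CommRing Q] {f : PowerSeries R} (hf : f.IsNormalized)
  {φ ψ : R →+* Q} {t : Q}

/-- Scaling the variable in the logarithm. -/
theorem subst_smul_map {f : PowerSeries R} (h : ∀ m, t * ψ (f.coeff m) = t ^ m * φ (f.coeff m))
    {τ : Type*} {s : MvPowerSeries τ Q} (hs : MvPowerSeries.constantCoeff s = 0) :
    subst (t • s) (f.map φ) = t • subst s (f.map ψ) := by
  have h0 : constantCoeff (t • X : PowerSeries Q) = 0 := by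
    simp [smul_eq_C_mul]
  have hs' := HasSubst.of_constantCoeff_zero hs
  have hr : rescale t (f.map φ) = t • f.map ψ := by
    ext m
    rw [coeff_rescale, coeff_map, map_smul, coeff_map, smul_eq_mul, h]
  rw [← subst_smul hs', ← hr, rescale_eq_subst, subst_subst h0 hs, subst_smul hs', subst_X hs']

/-- Writing `φ` and `ψ` as superscripts, `t f^ψ(X) = f^φ(tX)`, hence `t F^ψ(X, Y) = F^φ(tX, tY)`
since both sides have the same image under `f^φ`. Keeping the factor `t` on the left avoids dividing
by `t`. -/
theorem coeff_law_scale (h : ∀ m, t * ψ (f.coeff m) = t ^ m * φ (f.coeff m)) (n : Fin 2 →₀ ℕ) :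
    t * ψ (hf.law.toPowerSeries.coeff n) = t ^ n.degree * φ (hf.law.toPowerSeries.coeff n) := by
  have hφ := hf.map φ
  have h0 (χ : R →+* Q) := (hf.law.map χ).zero_constantCoeff
  have hlog (χ : R →+* Q) := hf.hasLog_law.map χ hf.law.zero_constantCoeff
  have hX (i : Fin 2) := MvPowerSeries.constantCoeff_X (R := Q) i
  have hs := MvPowerSeries.HasSubst.smul_X (R := Q) (fun _ : Fin 2 => t)
  have key : t • (hf.law.map ψ).toPowerSeries =
      MvPowerSeries.rescale (fun _ => t) (hf.law.map φ).toPowerSeries := by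
    refine hφ.subst_injective ?_ ?_ ?_
    · rw [MvPowerSeries.constantCoeff_smul, h0, smul_zero]
    · rw [← MvPowerSeries.coeff_zero_eq_constantCoeff_apply, MvPowerSeries.coeff_rescale,
        MvPowerSeries.coeff_zero_eq_constantCoeff_apply, h0, mul_zero]
    · rw [subst_smul_map h (h0 ψ), MvPowerSeries.rescale_eq_subst, ← mvSubst_subst (h0 φ) hs,
        FormalGroup.map_toPowerSeries, FormalGroup.map_toPowerSeries, hlog ψ, hlog φ,
        MvPowerSeries.subst_add hs, mvSubst_subst (hX _) hs, mvSubst_subst (hX _) hs,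
        MvPowerSeries.subst_X hs, MvPowerSeries.subst_X hs, smul_add]
      exact congrArg₂ _ (subst_smul_map h (hX 0)).symm (subst_smul_map h (hX 1)).symm
  have := congrArg (MvPowerSeries.coeff n) key
  rw [MvPowerSeries.coeff_rescale, MvPowerSeries.coeff_smul, FormalGroup.coeff_map,
    FormalGroup.coeff_map] at this
  rw [this]
  congr 1
  rw [Finsupp.prod_pow, Finset.prod_pow_eq_pow_sum, Finsupp.degree_eq_sum]

/-- The same scaling argument for `f⁻¹(r f(X))`, where `r` has to be fixed by the scaling: scalars
have degree `0`. -/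
theorem coeff_actSeries_scale (h : ∀ m, t * ψ (f.coeff m) = t ^ m * φ (f.coeff m)) {r : R}
    (hr : ψ r = φ r) (n : ℕ) :
    t * ψ ((hf.actSeries r).coeff n) = t ^ n * φ ((hf.actSeries r).coeff n) := by
  have hφ := hf.map φ
  have hψ := hf.map ψ
  have ht : constantCoeff (t • X : PowerSeries Q) = 0 := by
    simp [smul_eq_C_mul]
  have key : t • hψ.actSeries (ψ r) = rescale t (hφ.actSeries (φ r)) := by
    refine hφ.subst_injective ?_ ?_ ?_
    · rw [MvPowerSeries.constantCoeff_smul]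
      exact (congrArg (t • ·) (hψ.constantCoeff_actSeries _)).trans (smul_zero t)
    · rw [rescale_eq_subst]
      exact PowerSeries.constantCoeff_subst_eq_zero ht _ (hφ.constantCoeff_actSeries _)
    · have hX := subst_smul_map h (MvPowerSeries.constantCoeff_X (R := Q) ())
      rw [subst_smul_map h (hψ.constantCoeff_actSeries _), hψ.subst_actSeries, rescale_eq_subst,
        ← subst_subst (hφ.constantCoeff_actSeries _) ht, hφ.subst_actSeries,
        subst_smul (.of_constantCoeff_zero ht), smul_comm, hr]
      refine congrArg (φ r • ·) (Eq.symm (hX.trans ?_))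
      exact congrArg (t • ·) (X_subst _)
  have := congrArg (coeff n) key
  rwa [coeff_rescale, map_smul, ← hf.map_actSeries, ← hf.map_actSeries, coeff_map, coeff_map,
    smul_eq_mul] at this

end PowerSeries.IsNormalized

namespace LogRing

variable (q : ℕ) (k : Type w) [CommRing k]

/-- The homomorphism `ℓₙ ↦ ℓₙ T ^ (2 (q ^ n - 1))`. -/
def weightHom : LogRing.{v} q k →+* Polynomial (LogRing.{v} q k) :=
  lift (Polynomial.C.comp (algebraMap k (LogRing.{v} q k)))
    fun m => Polynomial.monomial (2 * (m - 1)) (var q k m)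

theorem weightHom_algebraMap (a : k) :
    weightHom.{v} q k (algebraMap k _ a) = Polynomial.C (algebraMap k _ a) :=
  lift_algebraMap _ _ a

/-- This is the scaling hypothesis with `t = T²`. The square accounts for the doubled degrees `2 (m
- 1)`. -/
theorem weightHom_coeff_log (m : ℕ) : Polynomial.X ^ 2 * weightHom.{v} q k ((log q k).coeff m) =
    (Polynomial.X ^ 2) ^ m * Polynomial.C ((log q k).coeff m) := by
  rw [← pow_mul]
  by_cases hm : m ∈ typicalExponents q
  · have h1 := hm.1
    rw [coeff_log_of_mem k ⟨m, hm⟩, weightHom, lift_var, ← Polynomial.C_mul_X_pow_eq_monomial]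
    have : 2 * m = 2 + 2 * (m - 1) := by omega
    rw [this, pow_add]
    ring
  · rcases eq_or_ne m 1 with rfl | hm1
    · rw [coeff_log_one, map_one, map_one]
    · rw [coeff_log_of_notMem k hm hm1, map_zero, map_zero, mul_zero, mul_zero]

/-- The monic polynomial `T²` is not a zero divisor, so the spare factor cancels. -/
theorem eq_monomial_of_X_sq_mul {R : Type*} [CommRing R] {P : Polynomial R} {d n : ℕ} {x : R}
    (hn : 2 * n = d + 2)
    (h : Polynomial.X ^ 2 * P = (Polynomial.X ^ 2) ^ n * Polynomial.C x) :
    P = Polynomial.monomial d x := by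
  rw [← pow_mul, hn, pow_add, mul_comm (Polynomial.X ^ d), mul_assoc] at h
  rw [(Polynomial.monic_X_pow 2).isRegular.left h, Polynomial.X_pow_mul,
    Polynomial.C_mul_X_pow_eq_monomial]

theorem weightHom_of_mem_coeffsOfDegree {d : ℕ} {x : LogRing.{v} q k}
    (hx : x ∈ (isNormalized_log q k).law.coeffsOfDegree d) :
    weightHom q k x = Polynomial.monomial d x := by
  obtain ⟨i, j, h, rfl⟩ := hx
  refine eq_monomial_of_X_sq_mul h (((isNormalized_log q k).coeff_law_scale
    (weightHom_coeff_log q k) _).trans ?_)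
  simp

theorem weightHom_of_mem_coeffsOfDegree_formalModule {d : ℕ} {x : LogRing.{v} q k}
    (hx : x ∈ ((isNormalized_log q k).formalModule k).coeffsOfDegree d) :
    weightHom q k x = Polynomial.monomial d x := by
  obtain hx | ⟨a, i, h, rfl⟩ := hx
  · exact weightHom_of_mem_coeffsOfDegree q k hx
  · exact eq_monomial_of_X_sq_mul h ((isNormalized_log q k).coeff_actSeries_scale
      (weightHom_coeff_log q k) (weightHom_algebraMap q k a) _)

end LogRing

section

variable {p : ℕ} [Fact p.Prime] {k : Type w} [CommRing k] [Algebra (LocalInt p) k]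
  {V : Type (max v w)} [CommRing V] [Algebra k V]

theorem FormalGroup.IsUniversalTypical.nonempty_gradedAlgebra {F : FormalGroup V}
    (hF : F.IsUniversalTypical k p) : Nonempty (GradedAlgebra (F.grading k)) := by
  obtain ⟨ι, hι, hFι, htop⟩ := hF.exists_algHom_logRing.{v}
  refine nonempty_gradedAlgebra_weightPiece htop hι (LogRing.weightHom p k)
    (LogRing.weightHom_algebraMap p k) fun d x hx => ?_
  apply LogRing.weightHom_of_mem_coeffsOfDegree
  rw [← hFι, ← FormalGroup.image_coeffsOfDegree]
  exact ⟨x, hx, rfl⟩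

theorem FormalModule.IsUniversalTypical.nonempty_gradedAlgebra {F : FormalModule k V}
    (hF : F.IsUniversalTypical p) : Nonempty (GradedAlgebra F.grading) := by
  obtain ⟨ι, hι, hFι, htop⟩ := hF.exists_algHom_logRing.{v}
  refine nonempty_gradedAlgebra_weightPiece htop hι (LogRing.weightHom p k)
    (LogRing.weightHom_algebraMap p k) fun d x hx => ?_
  apply LogRing.weightHom_of_mem_coeffsOfDegree_formalModule
  rw [← FormalModule.image_coeffsOfDegree hFι]
  exact ⟨x, hx, rfl⟩

end

/-! ### The ring of integers of a totally ramified extension of `ℚ_p` -/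

section RingOfIntegers

variable (p : ℕ) [hp : Fact p.Prime] (K : Type*) [Field K] [Algebra ℚ_[p] K]
  [Algebra ℤ_[p] K] [IsScalarTower ℤ_[p] ℚ_[p] K] (A : Type*) [CommRing A] [Algebra A K]
  [Algebra ℤ_[p] A] [IsScalarTower ℤ_[p] A K]
  [IsIntegralClosure A ℤ_[p] K]

theorem PadicInt.isTorsionFree_extension : Module.IsTorsionFree ℤ_[p] K := by
  have : FaithfulSMul ℤ_[p] K := by
    rw [faithfulSMul_iff_algebraMap_injective, IsScalarTower.algebraMap_eq ℤ_[p] ℚ_[p] K]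
    exact (algebraMap ℚ_[p] K).injective.comp (IsFractionRing.injective ℤ_[p] ℚ_[p])
  infer_instance

/-- In a totally ramified extension the residue field does not grow. -/
theorem PadicInt.card_quotient_of_ramificationIdx_eq [FiniteDimensional ℚ_[p] K]
    (m : Ideal A) [hm : m.IsMaximal]
    (htot : m.ramificationIdx ℤ_[p] = Module.finrank ℚ_[p] K) : Nat.card (A ⧸ m) = p := by
  have hinj := IsIntegralClosure.algebraMap_injective A ℤ_[p] K
  have := PadicInt.isTorsionFree_extension p K
  have : IsDomain A := hinj.isDomain (algebraMap A K)
  have : CharZero K := charZero_of_injective_algebraMap (algebraMap ℚ_[p] K).injective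
  have : Module.Finite ℤ_[p] A := IsIntegralClosure.finite ℤ_[p] ℚ_[p] K A
  have : Module.Free ℤ_[p] A := IsIntegralClosure.module_free ℤ_[p] ℚ_[p] K A
  have : Algebra.IsIntegral ℤ_[p] A := inferInstance
  let P := m.under ℤ_[p]
  have hP : P.IsMaximal := Ideal.IsMaximal.under ℤ_[p] m
  have hmP : m.LiesOver P := ⟨rfl⟩
  let : Fintype (P.primesOver A) := (Algebra.QuasiFinite.finite_primesOver P).fintype
  have hsum := Ideal.sum_ramification_inertia_eq_finrank (R := ℤ_[p]) (S := A) P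
  rw [IsIntegralClosure.rank ℤ_[p] ℚ_[p] K A] at hsum
  -- The term of `m` in `∑ e f = [K : ℚ_p]` cannot exceed the sum; as `e` is already the whole
  -- degree, `f = 1`.
  have hle : m.ramificationIdx ℤ_[p] * m.inertiaDeg ℤ_[p] ≤ Module.finrank ℚ_[p] K := by
    rw [← hsum]
    exact Finset.single_le_sum (f := fun q : P.primesOver A =>
      q.1.ramificationIdx ℤ_[p] * q.1.inertiaDeg ℤ_[p]) (fun _ _ => Nat.zero_le _)
      (Finset.mem_univ ⟨m, hm.isPrime, hmP⟩)
  have hpos : 0 < Module.finrank ℚ_[p] K := Module.finrank_pos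
  have hdeg : m.inertiaDeg ℤ_[p] = 1 := by
    refine le_antisymm ?_ (Ideal.inertiaDeg_pos m ℤ_[p])
    rw [htot] at hle
    exact Nat.le_of_mul_le_mul_left (by rwa [mul_one]) hpos
  rw [Ideal.inertiaDeg_eq_of_isMaximal P m] at hdeg
  have hPm : P = IsLocalRing.maximalIdeal ℤ_[p] := IsLocalRing.eq_maximalIdeal hP
  have hcard : Nat.card (ℤ_[p] ⧸ P) = p := by
    rw [hPm]
    exact (Nat.card_congr PadicInt.residueField.toEquiv).trans (Nat.card_zmod p)
  let : Field (ℤ_[p] ⧸ P) := Ideal.Quotient.field P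
  have := Module.natCard_eq_pow_finrank (K := ℤ_[p] ⧸ P) (V := A ⧸ m)
  rw [this, hdeg, pow_one, hcard]

end RingOfIntegers

theorem PadicInt.isDomain_and_charZero_integralClosure (p : ℕ) [Fact p.Prime] (K : Type*) [Field K]
    [Algebra ℚ_[p] K] [Algebra ℤ_[p] K] (A : Type*) [CommRing A] [Algebra A K] [Algebra ℤ_[p] A]
    [IsIntegralClosure A ℤ_[p] K] : IsDomain A ∧ CharZero A := by
  have hinj := IsIntegralClosure.algebraMap_injective A ℤ_[p] K
  have : CharZero K := charZero_of_injective_algebraMap (algebraMap ℚ_[p] K).injective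
  exact ⟨hinj.isDomain (algebraMap A K), ⟨fun m n h => by
    have := congrArg (algebraMap A K) h
    rwa [map_natCast, map_natCast, Nat.cast_inj] at this⟩⟩

/-- `ℤ_(p)` embeds into `A`, because a fraction that maps to `0` has numerator `0` in characteristic
zero. So `A` is torsion-free over a Dedekind domain, hence flat. -/
theorem LocalInt.flat_of_charZero {p : ℕ} [hp : Fact p.Prime] (A : Type*) [CommRing A] [IsDomain A]
    [CharZero A] [Algebra (LocalInt p) A] : Module.Flat (LocalInt p) A := by
  have : FaithfulSMul (LocalInt p) A := by
    rw [faithfulSMul_iff_algebraMap_injective, injective_iff_map_eq_zero]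
    intro x hx
    obtain ⟨⟨n, s⟩, h⟩ := IsLocalization.surj (Ideal.span {(p : ℤ)}).primeCompl x
    have h' := congrArg (algebraMap (LocalInt p) A) h
    rw [map_mul, hx, zero_mul, eq_intCast, map_intCast, eq_comm, Int.cast_eq_zero] at h'
    rw [h', map_zero] at h
    exact (IsLocalization.map_units (LocalInt p) s).mul_left_eq_zero.1 h
  have : IsDedekindDomain (LocalInt p) := inferInstance
  infer_instance

/-! ### The comparison map -/

namespace LogRing

variable {q : ℕ} {k : Type*} [CommRing k] {k' : Type*} [CommRing k']

/-- Functoriality of `LogRing q k` in `k`. -/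
def map (φ : k →+* k') : LogRing.{v} q k →+* LogRing.{v} q k' :=
  (Algebra.TensorProduct.map φ.toIntAlgHom
    (AlgHom.id ℤ (MvPolynomial (ULift.{v} (typicalExponents q)) ℚ))).toRingHom

theorem map_algebraMap (φ : k →+* k') (a : k) :
    map.{v} φ (algebraMap k (LogRing q k) a) = algebraMap k' (LogRing q k') (φ a) := by
  refine (Algebra.TensorProduct.map_tmul _ _ a 1).trans ?_
  rw [map_one]
  rfl

theorem map_var (φ : k →+* k') (m : typicalExponents q) :
    map.{v} φ (var q k m) = var q k' m := by
  refine (Algebra.TensorProduct.map_tmul _ _ 1 _).trans ?_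
  rw [map_one]
  rfl

theorem map_log (φ : k →+* k') : (log.{v} q k).map (map φ) = log q k' := by
  ext m
  rw [PowerSeries.coeff_map]
  by_cases hm : m ∈ typicalExponents q
  · rw [coeff_log_of_mem k ⟨m, hm⟩, coeff_log_of_mem k' ⟨m, hm⟩, map_var]
  · rcases eq_or_ne m 1 with rfl | hm1
    · rw [coeff_log_one, coeff_log_one, map_one]
    · rw [coeff_log_of_notMem k hm hm1, coeff_log_of_notMem k' hm hm1, map_zero]

theorem map_law_isNormalized_log (φ : k →+* k') :
    (isNormalized_log.{v} q k).law.map (map φ) = (isNormalized_log.{v} q k').law := by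
  rw [PowerSeries.IsNormalized.map_law]
  refine PowerSeries.IsNormalized.eq_law _ ?_
  have h (g) (hg : PowerSeries.IsNormalized g) (hlog : g = log.{v} q k') :
      hg.law.toPowerSeries.HasLog (log q k') := hlog ▸ hg.hasLog_law
  exact h _ _ (map_log φ)

/-- `LogRing q k` is compatible with base change. -/
theorem exists_baseChange_equiv [Algebra k k'] :
    ∃ e : k' ⊗[k] LogRing.{v} q k ≃ₗ[k'] LogRing.{v} q k',
      ∀ a x, e (a ⊗ₜ x) = a • map (algebraMap k k') x := by
  obtain ⟨e, he⟩ : ∃ e : k' ⊗[k] LogRing.{v} q k ≃ₗ[k'] LogRing.{v} q k',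
      ∀ a r y, e (a ⊗ₜ (r ⊗ₜ[ℤ] y : LogRing.{v} q k)) = ((r • a) ⊗ₜ[ℤ] y : LogRing.{v} q k') :=
    ⟨TensorProduct.AlgebraTensorModule.cancelBaseChange ℤ k k' k'
      (MvPolynomial (ULift.{v} (typicalExponents q)) ℚ), fun _ _ _ => rfl⟩
  refine ⟨e, fun a x => ?_⟩
  let M (x : LogRing.{v} q k) : Prop := e (a ⊗ₜ x) = a • map (algebraMap k k') x
  have hM (x y) (hx : M x) (hy : M y) : M (x + y) := by
    change e (a ⊗ₜ (x + y)) = a • map _ (x + y)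
    rw [TensorProduct.tmul_add, map_add, map_add, smul_add]
    exact congrArg₂ _ hx hy
  refine TensorProduct.induction_on (motive := M) x ?_ (fun r y => ?_) hM
  · change e (a ⊗ₜ (0 : LogRing.{v} q k)) = a • map _ 0
    rw [TensorProduct.tmul_zero, map_zero, map_zero, smul_zero]
  · refine (he a r y).trans ?_
    rw [Algebra.smul_def, mul_comm]
    rfl

end LogRing

/-- A version of `algHom_ext` for targets without a chosen `k`-algebra structure; agreement on
scalars becomes a hypothesis. -/
theorem FormalGroup.ringHom_ext {k R S : Type*} [CommRing k] [CommRing R] [CommRing S] [Algebra k R]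
    {F : FormalGroup R} (hF : Algebra.adjoin k (⋃ d, F.coeffsOfDegree d) = ⊤)
    {φ ψ : R →+* S} (hk : ∀ a, φ (algebraMap k R a) = ψ (algebraMap k R a))
    (h : F.map φ = F.map ψ) (x : R) : φ x = ψ x := by
  have hx : x ∈ Algebra.adjoin k (⋃ d, F.coeffsOfDegree d) := hF ▸ trivial
  induction hx using Algebra.adjoin_induction with
  | mem x hx =>
    obtain ⟨d, i, j, -, rfl⟩ := Set.mem_iUnion.1 hx
    rw [← coeff_map, h, coeff_map]
  | algebraMap a => exact hk a
  | add x y _ _ hx hy => rw [map_add, map_add, hx, hy]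
  | mul x y _ _ hx hy => rw [map_mul, map_mul, hx, hy]

section Comparison

variable {k A B V P Q : Type*} [CommRing k] [CommRing A] [Algebra k A] [CommRing B] [Algebra k B]
  [CommRing V] [Algebra k V] [Algebra A V] [IsScalarTower k A V] [CommRing P] [Algebra k P]
  [CommRing Q] [Algebra A Q]

theorem comparisonMap_tmul (γ : B →ₐ[k] V) (b : B) (a : A) :
    comparisonMap A γ (b ⊗ₜ a) = γ b * algebraMap A V a := rfl

/-- If `B → V` embeds into a base change `P → A ⊗ P`, then `B ⊗ A → V` is injective. -/
theorem comparisonMap_injective [Module.Flat k A] (γ : B →ₐ[k] V) {ι : B →ₐ[k] P}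
    (hι : Function.Injective ι) (κ : V →ₐ[A] Q) (j : P → Q) (e : A ⊗[k] P ≃ₗ[A] Q)
    (he : ∀ a x, e (a ⊗ₜ x) = a • j x) (hj : ∀ b, κ (γ b) = j (ι b)) :
    Function.Injective (comparisonMap A γ) := by
  -- Followed by `κ`, the comparison map is `ι ⊗ A` up to isomorphisms. Flatness makes this
  -- composite injective, whether or not `κ` is.
  have h (y : B ⊗[k] A) : κ (comparisonMap A γ y) =
      e (TensorProduct.comm k P A (ι.toLinearMap.rTensor A y)) := by
    induction y with
    | zero => simp
    | tmul b a =>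
      rw [comparisonMap_tmul, map_mul, AlgHom.commutes, hj, LinearMap.rTensor_tmul,
        TensorProduct.comm_tmul, he, mul_comm, ← Algebra.smul_def]
      rfl
    | add x y hx hy => simp only [map_add, hx, hy]
  refine Function.Injective.of_comp (f := κ) ?_
  have hinj := (e.injective.comp (TensorProduct.comm k P A).injective).comp
    (Module.Flat.rTensor_preserves_injective_linearMap (M := A) ι.toLinearMap hι)
  exact fun x y hxy => hinj ((h x).symm.trans (hxy.trans (h y)))

/-- The image of `B ⊗ A` in an `A`-algebra. -/
def comparisonImage (γ : B →ₐ[k] V) (κ : V →ₐ[A] Q) : Subalgebra A Q where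
  __ := ((κ : V →+* Q).comp (comparisonMap A γ : B ⊗[k] A →+* V)).range.toSubsemiring
  algebraMap_mem' a := ⟨1 ⊗ₜ a, by
    change κ (comparisonMap A γ (1 ⊗ₜ a)) = _
    rw [comparisonMap_tmul, map_one, one_mul, AlgHom.commutes]⟩

end Comparison

/-- The formal group law underlying a typical formal `A`-module is typical. -/
theorem FormalModule.IsTypical.toFormalGroup {k A : Type*} [CommRing k] [CommRing A] [Algebra k A]
    {R : Type u} [CommRing R] [Algebra A R] [Algebra k R] [IsScalarTower k A R] {q : ℕ}
    {F : FormalModule A R} (hF : F.IsTypical q) : F.toFormalGroup.IsTypical k q := by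
  obtain ⟨S, _, _, G, φ, hS, hG, h⟩ := hF
  let : Algebra k S := ((algebraMap A S).comp (algebraMap k A)).toAlgebra
  have : IsScalarTower k A S := .of_algebraMap_eq fun _ => rfl
  exact ⟨S, inferInstance, inferInstance, G.toFormalGroup, φ.restrictScalars k, hS, hG, h.1⟩

section

variable {k A : Type*} [CommRing k] [CommRing A] [Algebra k A] {B V : Type*} [CommRing B]
  [Algebra k B] [CommRing V] [Algebra A V] [Algebra k V] [IsScalarTower k A V]

/-- Classifying maps preserve degrees. -/
theorem FormalModule.apply_mem_grading {G : FormalGroup B} {F : FormalModule A V} {γ : B →ₐ[k] V}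
    (h : G.map (γ : B →+* V) = F.toFormalGroup) {d : ℕ} {x : B} (hx : x ∈ G.grading k d) :
    γ x ∈ F.grading d := by
  refine weightPiece_le (D := fun d => ((F.grading d).restrictScalars k).comap γ.toLinearMap)
    ?_ (fun {d e x y} hx hy => ?_) (fun d x hx => ?_) d hx
  · change γ 1 ∈ F.grading 0
    rw [map_one]
    exact one_mem_weightPiece
  · change γ (x * y) ∈ F.grading (d + e)
    rw [map_mul]
    exact mul_mem_weightPiece hx hy
  · refine subset_weightPiece (C := F.coeffsOfDegree) d (Or.inl ?_)
    rw [← h, ← FormalGroup.image_coeffsOfDegree]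
    exact ⟨x, hx, rfl⟩

end

/-! ### The comparison map between the classifying rings. -/

section

variable {p : ℕ} [Fact p.Prime] {A : Type u} [CommRing A] [Algebra (LocalInt p) A]
  {B : Type u} [CommRing B] [Algebra (LocalInt p) B] {G : FormalGroup B}
  {V : Type u} [CommRing V] [Algebra A V] [Algebra (LocalInt p) V] [IsScalarTower (LocalInt p) A V]
  {F : FormalModule A V} {γ : B →ₐ[LocalInt p] V}

/-- The map `BP_* → V^A → LogRing p A` agrees with `BP_* → LogRing p ℤ_(p) → LogRing p A`, because
both send `G` to the universal law and `BP_*` is generated by coefficients. -/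
theorem comparisonMap_injective_of_isUniversalTypical [Module.Flat (LocalInt p) A]
    (hG : G.IsUniversalTypical (LocalInt p) p) (hF : F.IsUniversalTypical p)
    (h : G.map (γ : B →+* V) = F.toFormalGroup) : Function.Injective (comparisonMap A γ) := by
  obtain ⟨ι, hι, hGι, htop⟩ := hG.exists_algHom_logRing.{u, 0}
  obtain ⟨κ, -, hFκ, -⟩ := hF.exists_algHom_logRing.{u, u}
  obtain ⟨e, he⟩ := LogRing.exists_baseChange_equiv.{u} (q := p) (k := LocalInt p) (k' := A)
  refine comparisonMap_injective γ hι κ _ e he fun b => ?_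
  refine FormalGroup.ringHom_ext htop (φ := (κ : V →+* LogRing p A).comp (γ : B →+* V))
    (ψ := (LogRing.map (algebraMap (LocalInt p) A)).comp (ι : B →+* LogRing p (LocalInt p)))
    (fun a => ?_) ?_ b
  · change κ (γ (algebraMap _ _ a)) = LogRing.map _ (ι (algebraMap _ _ a))
    rw [AlgHom.commutes, AlgHom.commutes, LogRing.map_algebraMap,
      IsScalarTower.algebraMap_apply (LocalInt p) A V, AlgHom.commutes]
  · rw [← FormalGroup.map_map, ← FormalGroup.map_map, h, hGι, LogRing.map_law_isNormalized_log]
    exact hFκ.1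

/-- The image of `B ⊗ A` in `LogRing p A` contains the coefficients of the universal law, so it
exhausts that ring up to powers of `p`. In particular it reaches the coefficients of the action,
which do not come from `B`. -/
theorem exists_comparisonMap_eq_pow_mul (hF : F.IsUniversalTypical p)
    (h : G.map (γ : B →+* V) = F.toFormalGroup) (x : V) :
    ∃ y N, comparisonMap A γ y = (p : V) ^ N * x := by
  obtain ⟨κ, hκ, hFκ, -⟩ := hF.exists_algHom_logRing.{u, u}
  obtain ⟨N, y, hy⟩ := LogRing.exists_pow_mul_mem (W := comparisonImage γ κ) (fun n => by
    refine ⟨G.toPowerSeries.coeff n ⊗ₜ 1, ?_⟩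
    have h' := hFκ.1
    rw [← h, FormalGroup.map_map] at h'
    have h'' := congrArg (fun H => H.toPowerSeries.coeff n) h'
    rw [FormalGroup.coeff_map] at h''
    refine Eq.trans ?_ h''
    change κ (comparisonMap A γ _) = κ (γ _)
    rw [comparisonMap_tmul, map_one, mul_one]) (κ x)
  refine ⟨y, N, hκ (Eq.trans hy ?_)⟩
  rw [map_mul, map_pow, map_natCast]

end

end

theorem mainTheorem8 (p : ℕ) [Fact p.Prime]
    -- `K` is a finite extension of `ℚ_p`, and `A` is its ring of integers
    (K : Type*) [Field K] [Algebra ℚ_[p] K] [FiniteDimensional ℚ_[p] K]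
    [Algebra ℤ_[p] K] [IsScalarTower ℤ_[p] ℚ_[p] K]
    (A : Type u) [CommRing A] [Algebra A K] [Algebra ℤ_[p] A] [IsScalarTower ℤ_[p] A K]
    [IsIntegralClosure A ℤ_[p] K]
    -- the (only) structure of a `ℤ_(p)`-algebra on `A`
    [Algebra (LocalInt p) A]
    -- `m` is the maximal ideal of `A`, and `K / ℚ_p` is totally ramified
    (m : Ideal A) [m.IsMaximal]
    (htot : m.ramificationIdx ℤ_[p] = Module.finrank ℚ_[p] K) :
    -- the classifying rings `BP_*` and `V^A` exist
    (∃ (BP : Type u) (_ : CommRing BP) (_ : Algebra (LocalInt p) BP) (G : FormalGroup BP),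
      G.IsUniversalTypical (LocalInt p) p) ∧
    (∃ (V : Type u) (_ : CommRing V) (_ : Algebra A V) (F : FormalModule A V),
      F.IsUniversalTypical (Nat.card (A ⧸ m))) ∧
    -- and have the following properties
    ∀ (BP : Type u) [CommRing BP] [Algebra (LocalInt p) BP] (G : FormalGroup BP)
      (_ : G.IsUniversalTypical (LocalInt p) p)
      (V : Type u) [CommRing V] [Algebra A V] [Algebra (LocalInt p) V]
      [IsScalarTower (LocalInt p) A V] (F : FormalModule A V)
      (_ : F.IsUniversalTypical (Nat.card (A ⧸ m))),
      -- they are graded rings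
      Nonempty (GradedAlgebra (G.grading (LocalInt p))) ∧ Nonempty (GradedAlgebra F.grading) ∧
      -- exactly one map `γ : BP_* → V^A` classifies the formal group law underlying `F`
      ∃ γ : BP →ₐ[LocalInt p] V,
        G.map (γ : BP →+* V) = F.toFormalGroup ∧
        (∀ γ' : BP →ₐ[LocalInt p] V, G.map (γ' : BP →+* V) = F.toFormalGroup → γ' = γ) ∧
        -- it preserves degrees
        (∀ (d : ℕ) (x : BP), x ∈ G.grading (LocalInt p) d → γ x ∈ F.grading d) ∧
        -- `BP_* ⊗ A → V^A` is injective, and bijective after inverting `p`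
        Function.Injective (comparisonMap A γ) ∧
        Function.Bijective
          (Localization.awayMap (comparisonMap A γ : BP ⊗[LocalInt p] A →+* V)
            (p : BP ⊗[LocalInt p] A)) := by
  have hq := PadicInt.card_quotient_of_ramificationIdx_eq p K A m htot
  obtain ⟨_, _⟩ := PadicInt.isDomain_and_charZero_integralClosure p K A
  have := LocalInt.flat_of_charZero (p := p) A
  rw [hq]
  obtain ⟨W, G, -, -, hG⟩ := FormalGroup.exists_isUniversalTypical.{u, 0} p (LocalInt p)
  obtain ⟨W', F, -, -, hF⟩ := FormalModule.exists_isUniversalTypical.{u, u} p A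
  refine ⟨⟨W, _, _, G, hG⟩, ⟨W', _, _, F, hF⟩, ?_⟩
  intro BP _ _ G hG V _ _ _ _ F hF
  -- As the residue cardinality has been replaced by `p`, the law underlying `F` is `p`-typical, and
  -- `BP_*` classifies it.
  obtain ⟨γ, hγ, huniq⟩ := hG.2 V F.toFormalGroup hF.1.toFormalGroup
  have hinj : Function.Injective (comparisonMap A γ) :=
    comparisonMap_injective_of_isUniversalTypical hG hF hγ
  refine ⟨FormalGroup.IsUniversalTypical.nonempty_gradedAlgebra.{u, 0} hG,
    FormalModule.IsUniversalTypical.nonempty_gradedAlgebra.{u, u} hF, γ, hγ, huniq,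
    fun _ _ => FormalModule.apply_mem_grading hγ, hinj, ?_, ?_⟩
  -- Injectivity before inverting `p` makes the exponent `0` sufficient.
  · refine Localization.awayMap_injective_iff.2 fun a ha => ⟨0, ?_⟩
    rw [pow_zero, one_mul]
    exact hinj (Eq.trans ha (map_zero _).symm)
  · refine Localization.awayMap_surjective_iff.2 fun x => ?_
    obtain ⟨y, N, hy⟩ := exists_comparisonMap_eq_pow_mul hF hγ x
    exact ⟨y, N, by rw [map_natCast]; exact hy⟩
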